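/- Consider the real linear time-invariant system $\Sigma$: $\dot x=Ax+Bu$, $y=Cx+Du$, with $x(t)\in\mathbb R^n$, $u(t)\in\mathbb R^m$, $y(t)\in\mathbb R^p$, $\operatorname{rank}\begin{bmatrix}B\\D\end{bmatrix}=m$ and $\operatorname{rank}\begin{bmatrix}C&D\end{bmatrix}=p$. Inputs are locally integrable on $[0,\infty)$ and solutions are understood in the Carathéodory sense. $\Sigma$ is called *strongly observable* if, for all inputs $u$ and all initial states, $y(t)=0$ for all $t\ge0$ implies $x(t)=0$ for all $t\ge0$; *strongly detectable* if, for all inputs and all initial states, $y(t)=0$ for all $t\ge 0$ implies $x(t)\to0$ as $t\to\infty$; *strong$^*$ detectable* if, for all inputs and all initial states, $y(t)\to0$ as $t\to\infty$ implies $x(t)\to0$ as $t\to\infty$. A *special coordinate basis* (SCB) of $\Sigma$ consists of nonsingular transformations $x=T_s\bar x$, $u=T_i\bar u$, $y=T_o\bar y$ with $\bar x=(x_a,x_b,x_c,x_d)\in\mathbb R^{n_a}\times\mathbb R^{n_b}\times\mathbb R^{n_c}\times\mathbb R^{n_d}$, $\bar u=(u_0,u_d,u_c)\in\mathbb R^{m_0}\times\mathbb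 R^{m_d}\times\mathbb R^{m_c}$, $\bar y=(y_0,y_d,y_b)\in\mathbb R^{m_0}\times\mathbb R^{m_d}\times\mathbb R^{p_b}$ such that, in the new coordinates, $$\dot{\bar x}=\left(\begin{bmatrix}A_a&H_{ab}C_b&0&H_{ad}C_d\\0&A_b&0&H_{bd}C_d\\B_cF_{ca}&H_{cb}C_b&A_c&H_{cd}C_d\\B_dF_{da}&B_dF_{db}&B_dF_{dc}&A_d\end{bmatrix}+B_0C_0\right)\bar x+\begin{bmatrix}B_{0a}&0&0\\B_{0b}&0&0\\B_{0c}&0&B_c\\B_{0d}&B_d&0\end{bmatrix}\bar u,$$ $$\bar y=\begin{bmatrix}C_{0a}&C_{0b}&C_{0c}&C_{0d}\\0&0&0&C_d\\0&C_b&0&0\end{bmatrix}\bar x+\begin{bmatrix}I_{m_0}&0&0\\0&0&0\\0&0&0\end{bmatrix}\bar u,$$ where $B_0=\begin{bmatrix}B_{0a}^T&B_{0b}^T&B_{0c}^T&B_{0d}^T\end{bmatrix}^T$, $C_0=\begin{bmatrix}C_{0a}&C_{0b}&C_{0c}&C_{0d}\end{bmatrix}$, the pair $(A_c,B_c)$ is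 controllable, and the following holds. Let $J_k$ be the $k\times k$ matrix with ones on the first superdiagonal and zeros elsewhere, $C_k=[1\;0\cdots0]\in\mathbb R^{1\times k}$ and $B_k=[0\cdots0\;1]^T\in\mathbb R^{k\times1}$. There are positive integers $l_1,\dots,l_{p_b}$ with $\sum_i l_i=n_b$, positive integers $q_1\ge\dots\ge q_{m_d}$ with $\sum_i q_i=n_d$ (the orders of the infinite zeros), and real matrices $H_{bb},F_{dd},H_{dd}$ with $$C_b=\operatorname{diag}(C_{l_1},\dots,C_{l_{p_b}}),\qquad A_b=\operatorname{diag}(J_{l_1},\dots,J_{l_{p_b}})+H_{bb}C_b,$$ $$B_d=\operatorname{diag}(B_{q_1},\dots,B_{q_{m_d}}),\quad C_d=\operatorname{diag}(C_{q_1},\dots,C_{q_{m_d}}),\quad A_d=\operatorname{diag}(J_{q_1},\dots,J_{q_{m_d}})+B_dF_{dd}+H_{dd}C_d.$$ All remaining matrices are arbitrary real matrices of matching sizes, and every block may be empty. Then, for every SCB of $\Sigma$: 1. $\Sigma$ is strongly observable if and only if $n_a=n_c=0$. 2. $\Sigma$ is strongly detectable if and only if $n_c=0$ and $A_a$ is Hurwitz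 (all its eigenvalues have negative real part). 3. $\Sigma$ is strong$^*$ detectable if and only if it is strongly detectable and $q_i=1$ for all $i=1,\dots,m_d$. 4. If $\Sigma$ is strongly detectable, then the rank condition $\operatorname{rank}\begin{bmatrix}CB&D\\D&0\end{bmatrix}=\operatorname{rank}D+\operatorname{rank}\begin{bmatrix}B\\D\end{bmatrix}=\operatorname{rank}D+m$ holds if and only if $q_i=1$ for all $i=1,\dots,m_d$. -/

import Mathlib

open Filter Topology MeasureTheory

/-- The linear time-invariant system `x' = A x + B u`, `y = C x + D u`, with state, input and
output coordinates indexed by `X`, `U`, `Y`. -/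
structure LTISystem (X U Y : Type) where
  A : Matrix X X ℝ
  B : Matrix X U ℝ
  C : Matrix Y X ℝ
  D : Matrix Y U ℝ

/-- `x` is the (Carathéodory) solution on `[0, ∞)` of `x' = A x + B u` for the locally integrable
input `u` and the initial value `x 0`. -/
structure IsTrajectory {X U : Type} [Fintype X] [Fintype U]
    (A : Matrix X X ℝ) (B : Matrix X U ℝ) (u : ℝ → U → ℝ) (x : ℝ → X → ℝ) : Prop where
  input_integrable : ∀ t : ℝ, 0 ≤ t → IntervalIntegrable u volume 0 t
  continuousOn : ContinuousOn x (Set.Ici 0)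
  eq_integral : ∀ t : ℝ, 0 ≤ t →
    x t = x 0 + ∫ s in (0 : ℝ)..t, (A.mulVec (x s) + B.mulVec (u s))

/-- The pair `(A, B)` is controllable: every state can be steered to every other state in finite
time. -/
def IsControllablePair {X U : Type} [Fintype X] [Fintype U]
    (A : Matrix X X ℝ) (B : Matrix X U ℝ) : Prop :=
  ∀ x₀ x₁ : X → ℝ, ∃ (T : ℝ) (u : ℝ → U → ℝ) (x : ℝ → X → ℝ),
    0 < T ∧ IsTrajectory A B u x ∧ x 0 = x₀ ∧ x T = x₁

/-- All complex eigenvalues of the real matrix `A` have negative real part. -/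
def IsHurwitz {X : Type} [Fintype X] [DecidableEq X] (A : Matrix X X ℝ) : Prop :=
  ∀ z ∈ spectrum ℂ (A.map Complex.ofReal), z.re < 0

/-- Invertibility of a matrix whose rows and columns are indexed by different types. -/
def IsNonsingular {X Y : Type} [Fintype X] [Fintype Y] [DecidableEq X] [DecidableEq Y]
    (T : Matrix X Y ℝ) : Prop :=
  ∃ T' : Matrix Y X ℝ, T * T' = 1 ∧ T' * T = 1

namespace LTISystem

section
variable {X U Y : Type} [Fintype X] [Fintype U]

/-- The output `y = C x + D u`. -/
def output (S : LTISystem X U Y) (u : ℝ → U → ℝ) (x : ℝ → X → ℝ) (t : ℝ) : Y → ℝ :=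
  S.C.mulVec (x t) + S.D.mulVec (u t)

/-- `y(t) = 0` for all `t ≥ 0` implies `x(t) = 0` for all `t ≥ 0`. -/
def StronglyObservable (S : LTISystem X U Y) : Prop :=
  ∀ (u : ℝ → U → ℝ) (x : ℝ → X → ℝ), IsTrajectory S.A S.B u x →
    (∀ t : ℝ, 0 ≤ t → S.output u x t = 0) → ∀ t : ℝ, 0 ≤ t → x t = 0

/-- `y(t) = 0` for all `t ≥ 0` implies `x(t) → 0`. -/
def StronglyDetectable (S : LTISystem X U Y) : Prop :=
  ∀ (u : ℝ → U → ℝ) (x : ℝ → X → ℝ), IsTrajectory S.A S.B u x →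
    (∀ t : ℝ, 0 ≤ t → S.output u x t = 0) → Tendsto x atTop (𝓝 0)

/-- `y(t) → 0` implies `x(t) → 0`. -/
def StrongStarDetectable (S : LTISystem X U Y) : Prop :=
  ∀ (u : ℝ → U → ℝ) (x : ℝ → X → ℝ), IsTrajectory S.A S.B u x →
    Tendsto (S.output u x) atTop (𝓝 0) → Tendsto x atTop (𝓝 0)

/-- The observer rank condition
`rank [C B, D; D, 0] = rank D + rank [B; D] = rank D + m`, with `m` the number of inputs. -/
def ObserverRankCondition (S : LTISystem X U Y) : Prop :=
  (Matrix.fromBlocks (S.C * S.B) S.D S.D 0).rank = S.D.rank + (Matrix.fromRows S.B S.D).rank ∧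
  S.D.rank + (Matrix.fromRows S.B S.D).rank = S.D.rank + Fintype.card U

end

end LTISystem

/-- The nilpotent Jordan block `J_k`, with ones on the first superdiagonal. -/
def jordanBlock (k : ℕ) : Matrix (Fin k) (Fin k) ℝ :=
  Matrix.of fun i j => if (i : ℕ) + 1 = j then 1 else 0

/-- `diag(J_{q 1}, …, J_{q r})`; the coordinate `⟨i, j⟩` is the `j`-th state of chain `i`. -/
def chainShift {r : ℕ} (q : Fin r → ℕ) :
    Matrix (Σ i, Fin (q i)) (Σ i, Fin (q i)) ℝ :=
  Matrix.blockDiagonal' fun i => jordanBlock (q i)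

/-- `diag(B_{q 1}, …, B_{q r})` with `B_k = (0, …, 0, 1)ᵀ`: the `i`-th input enters the last state
of chain `i`. -/
def chainInput {r : ℕ} (q : Fin r → ℕ) : Matrix (Σ i, Fin (q i)) (Fin r) ℝ :=
  Matrix.of fun s i => if s.1 = i ∧ (s.2 : ℕ) + 1 = q s.1 then 1 else 0

/-- `diag(C_{q 1}, …, C_{q r})` with `C_k = (1, 0, …, 0)`: the `i`-th output is the first state of
chain `i`. -/
def chainOutput {r : ℕ} (q : Fin r → ℕ) : Matrix (Fin r) (Σ i, Fin (q i)) ℝ :=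
  Matrix.of fun i s => if s.1 = i ∧ (s.2 : ℕ) = 0 then 1 else 0

/-- The sizes and coefficient matrices of a system in the special coordinate basis. The sizes
`n_b = ∑ i, l i` and `n_d = ∑ i, q i` are those of the index types `Σ i, Fin (l i)` and
`Σ i, Fin (q i)`. -/
structure SCBForm where
  (na nc m0 md mc pb : ℕ)
  l : Fin pb → ℕ
  l_pos : ∀ i, 0 < l i
  q : Fin md → ℕ
  q_pos : ∀ i, 0 < q i
  q_antitone : Antitone q
  Aa : Matrix (Fin na) (Fin na) ℝ
  Hab : Matrix (Fin na) (Fin pb) ℝ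
  Had : Matrix (Fin na) (Fin md) ℝ
  Hbb : Matrix (Σ i, Fin (l i)) (Fin pb) ℝ
  Hbd : Matrix (Σ i, Fin (l i)) (Fin md) ℝ
  Ac : Matrix (Fin nc) (Fin nc) ℝ
  Bc : Matrix (Fin nc) (Fin mc) ℝ
  controllable_c : IsControllablePair Ac Bc
  Fca : Matrix (Fin mc) (Fin na) ℝ
  Hcb : Matrix (Fin nc) (Fin pb) ℝ
  Hcd : Matrix (Fin nc) (Fin md) ℝ
  Fda : Matrix (Fin md) (Fin na) ℝ
  Fdb : Matrix (Fin md) (Σ i, Fin (l i)) ℝ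
  Fdc : Matrix (Fin md) (Fin nc) ℝ
  Fdd : Matrix (Fin md) (Σ i, Fin (q i)) ℝ
  Hdd : Matrix (Σ i, Fin (q i)) (Fin md) ℝ
  B0a : Matrix (Fin na) (Fin m0) ℝ
  B0b : Matrix (Σ i, Fin (l i)) (Fin m0) ℝ
  B0c : Matrix (Fin nc) (Fin m0) ℝ
  B0d : Matrix (Σ i, Fin (q i)) (Fin m0) ℝ
  C0a : Matrix (Fin m0) (Fin na) ℝ
  C0b : Matrix (Fin m0) (Σ i, Fin (l i)) ℝ
  C0c : Matrix (Fin m0) (Fin nc) ℝ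
  C0d : Matrix (Fin m0) (Σ i, Fin (q i)) ℝ

namespace SCBForm

/-- State coordinates `((x_a, x_b), (x_c, x_d))`. -/
abbrev StateIdx (F : SCBForm) : Type :=
  (Fin F.na ⊕ (Σ i, Fin (F.l i))) ⊕ (Fin F.nc ⊕ (Σ i, Fin (F.q i)))

/-- Input coordinates `(u_0, (u_d, u_c))`. -/
abbrev InputIdx (F : SCBForm) : Type := Fin F.m0 ⊕ (Fin F.md ⊕ Fin F.mc)

/-- Output coordinates `(y_0, (y_d, y_b))`. -/
abbrev OutputIdx (F : SCBForm) : Type := Fin F.m0 ⊕ (Fin F.md ⊕ Fin F.pb)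

/-- `C_b`. -/
def Cb (F : SCBForm) : Matrix (Fin F.pb) (Σ i, Fin (F.l i)) ℝ := chainOutput F.l

/-- `A_b = A_b^⋆ + H_bb C_b`. -/
def Ab (F : SCBForm) : Matrix (Σ i, Fin (F.l i)) (Σ i, Fin (F.l i)) ℝ :=
  chainShift F.l + F.Hbb * F.Cb

/-- `B_d`. -/
def Bd (F : SCBForm) : Matrix (Σ i, Fin (F.q i)) (Fin F.md) ℝ := chainInput F.q

/-- `C_d`. -/
def Cd (F : SCBForm) : Matrix (Fin F.md) (Σ i, Fin (F.q i)) ℝ := chainOutput F.q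

/-- `A_d = A_d^⋆ + B_d F_dd + H_dd C_d`. -/
def Ad (F : SCBForm) : Matrix (Σ i, Fin (F.q i)) (Σ i, Fin (F.q i)) ℝ :=
  chainShift F.q + F.Bd * F.Fdd + F.Hdd * F.Cd

/-- The column of blocks `B_0a, B_0b, B_0c, B_0d`. -/
def B0 (F : SCBForm) : Matrix F.StateIdx (Fin F.m0) ℝ :=
  Matrix.fromRows (Matrix.fromRows F.B0a F.B0b) (Matrix.fromRows F.B0c F.B0d)

/-- The row of blocks `C_0a, C_0b, C_0c, C_0d`. -/
def C0 (F : SCBForm) : Matrix (Fin F.m0) F.StateIdx ℝ :=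
  Matrix.fromCols (Matrix.fromCols F.C0a F.C0b) (Matrix.fromCols F.C0c F.C0d)

/-- The system in special coordinates. -/
def toLTISystem (F : SCBForm) : LTISystem F.StateIdx F.InputIdx F.OutputIdx where
  A := Matrix.fromBlocks
        (Matrix.fromBlocks
          F.Aa (F.Hab * F.Cb)
          0    F.Ab)
        (Matrix.fromBlocks
          0 (F.Had * F.Cd)
          0 (F.Hbd * F.Cd))
        (Matrix.fromBlocks
          (F.Bc * F.Fca) (F.Hcb * F.Cb)
          (F.Bd * F.Fda) (F.Bd * F.Fdb))
        (Matrix.fromBlocks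
          F.Ac           (F.Hcd * F.Cd)
          (F.Bd * F.Fdc) F.Ad)
      + F.B0 * F.C0
  B := Matrix.fromCols F.B0
        (Matrix.fromRows
          0
          (Matrix.fromBlocks
            0    F.Bc
            F.Bd 0))
  C := Matrix.fromRows F.C0
        (Matrix.fromCols
          (Matrix.fromBlocks
            0 0
            0 F.Cb)
          (Matrix.fromBlocks
            0 F.Cd
            0 0))
  D := Matrix.fromBlocks 1 0 0 0

end SCBForm

/-- A special coordinate basis of `S`: nonsingular transformations `x = Ts x̄`, `u = Ti ū`,
`y = To ȳ` which bring `S` into the form `form`. -/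
structure LTISystem.SCB {X U Y : Type} [Fintype X] [Fintype U] [Fintype Y]
    [DecidableEq X] [DecidableEq U] [DecidableEq Y] (S : LTISystem X U Y) where
  form : SCBForm
  Ts : Matrix X form.StateIdx ℝ
  Ti : Matrix U form.InputIdx ℝ
  To : Matrix Y form.OutputIdx ℝ
  Ts_nonsingular : IsNonsingular Ts
  Ti_nonsingular : IsNonsingular Ti
  To_nonsingular : IsNonsingular To
  A_eq : S.A * Ts = Ts * form.toLTISystem.A
  B_eq : S.B * Ti = Ts * form.toLTISystem.B
  C_eq : S.C * Ts = To * form.toLTISystem.C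
  D_eq : S.D * Ti = To * form.toLTISystem.D

open scoped Matrix

/-! All properties involved are invariant under nonsingular changes of coordinates
(`LTISystem.Similar`), so everything is decided in the special coordinates, where `y_0 = C_0 x +
u_0` enters the state equation through `B_0` and the inputs `u_d`, `u_c` can cancel every feedback
term (`SCBForm.rhs_eq`, `SCBForm.exists_input`).

If `y = 0`, then `x_b` and `x_d` vanish state by state along their integrator chains
(`IsTrajectory.chain_eq_zero`), and `x_a` evolves freely under `A_a`. Conversely, every free motion
of `x_a`, and every constant `x_c = v` with `A_c v + B_c w = 0`, occurs with zero output. Eigenmodes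
of `A_a` then give the conditions on `x_a`. The constant states give `n_c = 0`: if only `v = 0` is
possible, then `A_c` is invertible and `B_c = 0`, which controllability forbids in positive
dimension.

If only `y → 0` is known and all `q_i = 1`, then `x_d = y_d → 0`, and `x_a`, as well as `x_b` after
an output injection placing its eigenvalues at `-1`, solves a Hurwitz equation with forcing tending
to zero (`IsHurwitz.tendsto_zero`). If some `q_i ≥ 2`, one wants `y_d = f e_i` with `f → 0` but `f'`
not tending to zero, since `f'` appears, up to a multiple of `f`, in the second state of the chain.
The difficulty is that `f` drives the possibly unstable pair `(x_a, x_b)`. Taking `f = p(d/dt) g`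
with `p` the characteristic polynomial of that pair, Cayley–Hamilton supplies a response built from
derivatives of `g`, which tends to zero (`exists_oscillating_response`).

The rank condition says that `D v = 0` and `C B v ∈ im D` force `v = 0`. In special coordinates `C_d
B_d` is diagonal with entry `1` where `q_i = 1` and `0` elsewhere. -/

theorem HasDerivAt.mulVec {𝕜 X Y : Type*} [RCLike 𝕜] [Fintype X] [Fintype Y] (A : Matrix Y X 𝕜)
    {x : ℝ → X → 𝕜} {x' : X → 𝕜} {t : ℝ} (h : HasDerivAt x x' t) :
    HasDerivAt (fun s => A *ᵥ x s) (A *ᵥ x') t :=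
  ((A.mulVecLin.restrictScalars ℝ).toContinuousLinearMap.hasFDerivAt (x := x t)).comp_hasDerivAt t h

theorem Filter.Tendsto.mulVec_zero {𝕜 X Y α : Type*} [RCLike 𝕜] [Fintype X] [Fintype Y]
    (A : Matrix Y X 𝕜) {x : α → X → 𝕜} {l : Filter α} (h : Tendsto x l (𝓝 0)) :
    Tendsto (fun s => A *ᵥ x s) l (𝓝 0) := by
  have := ((continuous_const (y := A)).matrix_mulVec continuous_id).tendsto 0
  simpa [Function.comp_def] using this.comp h

theorem IntervalIntegrable.mulVec {X Y : Type*} [Fintype X] [Fintype Y] (A : Matrix Y X ℝ)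
    {x : ℝ → X → ℝ} {a b : ℝ} (h : IntervalIntegrable x volume a b) :
    IntervalIntegrable (fun s => A *ᵥ x s) volume a b :=
  ⟨A.mulVecLin.toContinuousLinearMap.integrable_comp h.1,
    A.mulVecLin.toContinuousLinearMap.integrable_comp h.2⟩

/-! ### Carathéodory trajectories and their images under linear maps. -/

namespace IsTrajectory

variable {X U Z V : Type} [Fintype X] [Fintype U] [Fintype Z] [Fintype V]
  {A : Matrix X X ℝ} {B : Matrix X U ℝ} {u : ℝ → U → ℝ} {x : ℝ → X → ℝ}

theorem intervalIntegrable_state (h : IsTrajectory A B u x) {t : ℝ} (ht : 0 ≤ t) :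
    IntervalIntegrable x volume 0 t :=
  (h.continuousOn.mono (by rw [Set.uIcc_of_le ht]; exact Set.Icc_subset_Ici_self)).intervalIntegrable

theorem intervalIntegrable_rhs (h : IsTrajectory A B u x) {t : ℝ} (ht : 0 ≤ t) :
    IntervalIntegrable (fun s => A *ᵥ x s + B *ᵥ u s) volume 0 t :=
  ((h.intervalIntegrable_state ht).mulVec A).add ((h.input_integrable t ht).mulVec B)

theorem map (h : IsTrajectory A B u x) (P : (X → ℝ) →L[ℝ] (Z → ℝ)) {M : Matrix Z Z ℝ}
    {N : Matrix Z V ℝ} {v : ℝ → V → ℝ} (hv : ∀ t : ℝ, 0 ≤ t → IntervalIntegrable v volume 0 t)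
    (heq : ∀ t, P (A *ᵥ x t + B *ᵥ u t) = M *ᵥ P (x t) + N *ᵥ v t) :
    IsTrajectory M N v (fun t => P (x t)) where
  input_integrable := hv
  continuousOn := P.continuous.comp_continuousOn h.continuousOn
  eq_integral t ht := by
    simp_rw [← heq]
    rw [P.intervalIntegral_comp_comm (h.intervalIntegrable_rhs ht), ← map_add]
    exact congrArg P (h.eq_integral t ht)

theorem map_forced [DecidableEq Z] (h : IsTrajectory A B u x) (P : (X → ℝ) →L[ℝ] (Z → ℝ))
    {M : Matrix Z Z ℝ} {e : ℝ → Z → ℝ}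
    (heq : ∀ t, P (A *ᵥ x t + B *ᵥ u t) = M *ᵥ P (x t) + e t) :
    IsTrajectory M 1 e (fun t => P (x t)) := by
  refine h.map P (fun t ht => ?_) (by simpa using heq)
  -- Solving for the forcing makes its local integrability automatic, whatever inputs it is
  -- assembled from.
  have he : e = fun s => P (A *ᵥ x s + B *ᵥ u s) - M *ᵥ P (x s) := by
    funext s; rw [heq]; simp
  have hP : ∀ {f : ℝ → X → ℝ}, IntervalIntegrable f volume 0 t →
      IntervalIntegrable (fun s => P (f s)) volume 0 t := fun hf =>
    ⟨P.integrable_comp hf.1, P.integrable_comp hf.2⟩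
  rw [he]
  exact (hP (h.intervalIntegrable_rhs ht)).sub ((hP (h.intervalIntegrable_state ht)).mulVec M)

theorem of_hasDerivAt (hu : Continuous u) (hx : ∀ t, HasDerivAt x (A *ᵥ x t + B *ᵥ u t) t) :
    IsTrajectory A B u x where
  input_integrable t _ := hu.intervalIntegrable 0 t
  continuousOn := (continuous_iff_continuousAt.2 fun t => (hx t).continuousAt).continuousOn
  eq_integral t _ := by
    have hc : Continuous x := continuous_iff_continuousAt.2 fun t => (hx t).continuousAt
    rw [intervalIntegral.integral_eq_sub_of_hasDerivAt (fun s _ => hx s)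
      ((by fun_prop : Continuous fun s => A *ᵥ x s + B *ᵥ u s).intervalIntegrable _ _)]
    simp

end IsTrajectory

/-- Differentiating the primitive gives the claim for `t > 0`; continuity from the right covers `t =
0`. -/
theorem eq_zero_of_integral_eq_zero {w : ℝ → ℝ} (hw : ContinuousOn w (Set.Ici 0))
    (h : ∀ t, 0 ≤ t → ∫ s in (0 : ℝ)..t, w s = 0) : ∀ t, 0 ≤ t → w t = 0 := by
  let W : ℝ → ℝ := fun t => w (max t 0)
  have hW : Continuous W := hw.comp_continuous (by fun_prop) (fun t => le_max_right t 0)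
  have hI : ∀ t, 0 ≤ t → ∫ s in (0 : ℝ)..t, W s = 0 := fun t ht => by
    refine (intervalIntegral.integral_congr fun s hs => ?_).trans (h t ht)
    rw [Set.uIcc_of_le ht] at hs
    simp [W, max_eq_left hs.1]
  have hpos : ∀ t, 0 < t → w t = 0 := fun t ht => by
    have h1 := (hW.integral_hasStrictDerivAt 0 t).hasDerivAt
    have h2 : HasDerivAt (fun t => ∫ s in (0 : ℝ)..t, W s) 0 t :=
      (hasDerivAt_const t (0 : ℝ)).congr_of_eventuallyEq
        (by filter_upwards [lt_mem_nhds ht] with s hs using hI s hs.le)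
    have := h1.unique h2
    simpa [W, max_eq_left ht.le] using this
  intro t ht
  rcases ht.eq_or_lt with rfl | ht
  · have h1 : Tendsto W (𝓝[>] 0) (𝓝 (W 0)) := hW.continuousAt.tendsto.mono_left nhdsWithin_le_nhds
    have h2 : Tendsto W (𝓝[>] 0) (𝓝 0) := tendsto_const_nhds.congr' <| by
      filter_upwards [self_mem_nhdsWithin] with s hs
      have hs' : (0 : ℝ) < s := hs
      simp [W, max_eq_left hs'.le, hpos s hs']
    simpa [W] using tendsto_nhds_unique h1 h2
  · exact hpos t ht

/-! ### Stable linear equations with vanishing forcing. -/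

/-- Reduces a merely integrable forcing to the differentiable setting. With `E = ∫ e`, replace
`E(t)` in `x = x(0) + ∫ A x + E` by its mean over `[t, t+1]`. Since `e → 0`, `E` varies little over
unit intervals, so the change tends to zero, and the mean has derivative `E(t+1) - E(t) → 0`. -/
theorem IsTrajectory.exists_hasDerivAt_approx {X : Type} [Fintype X] [DecidableEq X]
    {A : Matrix X X ℝ} {e x : ℝ → X → ℝ} (h : IsTrajectory A 1 e x) (he : Tendsto e atTop (𝓝 0)) :
    ∃ z e' : ℝ → X → ℝ, (∀ t, HasDerivAt z (A *ᵥ z t + e' t) t) ∧ Tendsto e' atTop (𝓝 0) ∧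
      Tendsto (x - z) atTop (𝓝 0) := by
  let x₁ : ℝ → X → ℝ := fun t => x (max t 0)
  have hx₁ : Continuous x₁ := h.continuousOn.comp_continuous (by fun_prop) (fun t => le_max_right t 0)
  let I : ℝ → X → ℝ := fun t => ∫ s in (0 : ℝ)..t, A *ᵥ x₁ s
  have hI : ∀ t, HasDerivAt I (A *ᵥ x₁ t) t := fun t =>
    ((by fun_prop : Continuous fun s => A *ᵥ x₁ s).integral_hasStrictDerivAt 0 t).hasDerivAt
  have hIc : Continuous I := continuous_iff_continuousAt.2 fun t => (hI t).continuousAt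
  let E : ℝ → X → ℝ := fun t => x₁ t - x 0 - I t
  have hE : Continuous E := by fun_prop
  have hEint : ∀ t, 0 ≤ t → E t = ∫ s in (0 : ℝ)..t, e s := fun t ht => by
    have h1 := h.eq_integral t ht
    simp only [Matrix.one_mulVec] at h1
    rw [intervalIntegral.integral_add ((h.intervalIntegrable_state ht).mulVec A)
      (h.input_integrable t ht)] at h1
    have h2 : I t = ∫ s in (0 : ℝ)..t, A *ᵥ x s := by
      refine intervalIntegral.integral_congr fun s hs => ?_
      rw [Set.uIcc_of_le ht] at hs
      simp [x₁, max_eq_left hs.1]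
    simp only [E, x₁, max_eq_left ht, h2]
    rw [h1]; abel
  let G : ℝ → X → ℝ := fun t => ∫ s in (0 : ℝ)..t, E s
  have hG : ∀ t, HasDerivAt G (E t) t := fun t => (hE.integral_hasStrictDerivAt 0 t).hasDerivAt
  have hsmall : ∀ ε > 0, ∃ t₀, 0 ≤ t₀ ∧ ∀ t, t₀ ≤ t → ∀ s ∈ Set.Icc t (t + 1), ‖E s - E t‖ ≤ ε := by
    intro ε hε
    obtain ⟨t₀, ht₀⟩ := eventually_atTop.1 ((tendsto_zero_iff_norm_tendsto_zero.1 he).eventually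
      (ge_mem_nhds hε))
    refine ⟨max t₀ 0, le_max_right _ _, fun t ht s hs => ?_⟩
    have ht0 : 0 ≤ t := (le_max_right _ _).trans ht
    rw [hEint t ht0, hEint s (ht0.trans hs.1), intervalIntegral.integral_interval_sub_left
      (h.input_integrable s (ht0.trans hs.1)) (h.input_integrable t ht0)]
    refine (intervalIntegral.norm_integral_le_of_norm_le_const (C := ε) fun r hr => ?_).trans ?_
    · rw [Set.uIoc_of_le hs.1] at hr
      exact ht₀ r (((le_max_left _ _).trans ht).trans hr.1.le)
    · rw [abs_of_nonneg (by linarith [hs.1])]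
      nlinarith [hs.2]
  have hr : Tendsto (fun t => E t - (G (t + 1) - G t)) atTop (𝓝 0) := by
    refine Metric.tendsto_atTop.2 fun ε hε => ?_
    obtain ⟨t₀, h0, ht₀⟩ := hsmall (ε / 2) (by positivity)
    refine ⟨t₀, fun t ht => ?_⟩
    have h1 : G (t + 1) - G t - E t = ∫ s in t..(t + 1), (E s - E t) := by
      rw [intervalIntegral.integral_sub (hE.intervalIntegrable _ _) (by simp),
        intervalIntegral.integral_interval_sub_left (hE.intervalIntegrable _ _)
          (hE.intervalIntegrable _ _)]
      simp
    rw [dist_zero_right, ← norm_neg, neg_sub, h1]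
    refine (intervalIntegral.norm_integral_le_of_norm_le_const (C := ε / 2) fun r hr => ?_).trans_lt ?_
    · rw [Set.uIoc_of_le (by linarith)] at hr
      exact ht₀ t ht r ⟨hr.1.le, hr.2⟩
    · simp; linarith
  have hd : Tendsto (fun t => E (t + 1) - E t) atTop (𝓝 0) := by
    refine Metric.tendsto_atTop.2 fun ε hε => ?_
    obtain ⟨t₀, h0, ht₀⟩ := hsmall (ε / 2) (by positivity)
    refine ⟨t₀, fun t ht => ?_⟩
    rw [dist_zero_right]
    linarith [ht₀ t ht (t + 1) ⟨by linarith, le_rfl⟩]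
  refine ⟨fun t => x 0 + I t + (G (t + 1) - G t),
    fun t => A *ᵥ (E t - (G (t + 1) - G t)) + (E (t + 1) - E t), fun t => ?_, ?_, ?_⟩
  · have h1 := ((hI t).const_add (x 0)).add (((hG (t + 1)).comp_add_const t 1).sub (hG t))
    refine h1.congr_deriv ?_
    rw [← add_assoc, ← Matrix.mulVec_add]
    congr 2
    simp only [E]; abel
  · simpa using (hr.mulVec_zero A).add hd
  · refine hr.congr' ?_
    filter_upwards [eventually_ge_atTop 0] with t ht
    simp only [E, x₁, max_eq_left ht, Pi.sub_apply]; abel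

/-- The integrating factor `exp (-lam t)` removes the linear term; the derivative that remains is
eventually at most `(ε μ / 2) exp (μ t)` in norm, which integrates to `(ε / 2) exp (μ t)`. -/
theorem tendsto_zero_of_hasDerivAt_smul {E : Type*} [NormedAddCommGroup E] [NormedSpace ℂ E]
    {lam : ℂ} (hlam : lam.re < 0) {x e : ℝ → E} (hx : ∀ t, HasDerivAt x (lam • x t + e t) t)
    (he : Tendsto e atTop (𝓝 0)) : Tendsto x atTop (𝓝 0) := by
  set μ := -lam.re with hμ
  have hμ0 : 0 < μ := by linarith
  have hw : ∀ t : ℝ, HasDerivAt (fun s : ℝ => Complex.exp (-lam * s) • x s)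
      (Complex.exp (-lam * t) • e t) t := fun t => by
    have h1 : HasDerivAt (fun s : ℝ => Complex.exp (-lam * s)) (Complex.exp (-lam * t) * (-lam)) t := by
      have := ((hasDerivAt_id (t : ℂ)).const_mul (-lam)).cexp.comp_ofReal
      simpa using this
    refine (h1.smul (hx t)).congr_deriv ?_
    rw [smul_add, smul_smul]
    module
  have hn : ∀ t : ℝ, ‖Complex.exp (-lam * t)‖ = Real.exp (μ * t) := fun t => by
    rw [Complex.norm_exp]; simp [hμ]
  refine Metric.tendsto_atTop'.2 fun ε hε => ?_
  obtain ⟨t₀, ht₀⟩ := eventually_atTop.1 ((tendsto_zero_iff_norm_tendsto_zero.1 he).eventually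
      (ge_mem_nhds (show 0 < ε * μ / 2 by positivity)))
  set K := ‖Complex.exp (-lam * t₀) • x t₀‖ with hK
  have hbound : ∀ t, t₀ ≤ t → ‖Complex.exp (-lam * t) • x t‖ ≤ K + ε / 2 * Real.exp (μ * t) := by
    intro t ht
    refine image_norm_le_of_norm_deriv_right_le_deriv_boundary (a := t₀) (b := t)
      (B := fun t => K + ε / 2 * Real.exp (μ * t))
      (B' := fun t => ε * μ / 2 * Real.exp (μ * t))
      (fun s _ => (hw s).continuousAt.continuousWithinAt) (fun s _ => (hw s).hasDerivWithinAt) ?_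
      (fun s => ?_) (fun s hs => ?_) ⟨ht, le_rfl⟩
    · rw [← hK]; linarith [show 0 ≤ ε / 2 * Real.exp (μ * t₀) by positivity]
    · have := (((hasDerivAt_id s).const_mul μ).exp.const_mul (ε / 2)).const_add K
      refine this.congr_deriv ?_
      simp; ring
    · rw [norm_smul, hn, mul_comm]
      exact mul_le_mul_of_nonneg_right (ht₀ s hs.1) (Real.exp_pos _).le
  have hKt : Tendsto (fun t : ℝ => K * Real.exp (-(μ * t))) atTop (𝓝 0) := by
    have : Tendsto (fun t : ℝ => Real.exp (-(μ * t))) atTop (𝓝 0) :=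
      Real.tendsto_exp_neg_atTop_nhds_zero.comp (tendsto_id.const_mul_atTop hμ0)
    simpa using this.const_mul K
  obtain ⟨t₁, ht₁⟩ := eventually_atTop.1 (hKt.eventually (gt_mem_nhds (show 0 < ε / 2 by positivity)))
  refine ⟨max t₀ t₁, fun t ht => ?_⟩
  have h1 := hbound t ((le_max_left _ _).trans ht.le)
  have h2 := ht₁ t ((le_max_right _ _).trans ht.le)
  rw [norm_smul, hn] at h1
  rw [dist_zero_right]
  have h3 : Real.exp (μ * t) * Real.exp (-(μ * t)) = 1 := by rw [← Real.exp_add]; simp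
  have h4 := mul_le_mul_of_nonneg_right h1 (Real.exp_pos (-(μ * t))).le
  have h5 : Real.exp (μ * t) * ‖x t‖ * Real.exp (-(μ * t)) = ‖x t‖ := by
    rw [mul_right_comm, h3, one_mul]
  rw [h5, add_mul, mul_assoc (ε / 2), h3] at h4
  linarith

/-- Peels off one eigenvalue at a time, so that neither Jordan form nor matrix exponential is
needed: `(A - z) x` solves the same equation with forcing `(A - z) e`, hence tends to zero by
induction, and then `x' = z x + ((A - z) x + e)` is a scalar problem. -/
theorem tendsto_zero_of_aeval_prod {X : Type*} [Fintype X] [DecidableEq X] (A : Matrix X X ℂ)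
    (s : Multiset ℂ) (hs : ∀ z ∈ s, z.re < 0) :
    ∀ x e : ℝ → X → ℂ, (∀ t, HasDerivAt x (A *ᵥ x t + e t) t) → Tendsto e atTop (𝓝 0) →
      Tendsto (fun t => (Polynomial.aeval A (s.map fun z => Polynomial.X - Polynomial.C z).prod) *ᵥ x t)
        atTop (𝓝 0) → Tendsto x atTop (𝓝 0) := by
  induction s using Multiset.induction with
  | empty => intro x e _ _ h; simpa using h
  | cons z s ih =>
    intro x e hx he h
    have h1 : Tendsto (fun t => (A - algebraMap ℂ _ z) *ᵥ x t) atTop (𝓝 0) := by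
      refine ih (fun w hw => hs w (Multiset.mem_cons_of_mem hw)) _
        (fun t => (A - algebraMap ℂ _ z) *ᵥ e t) (fun t => ?_) (he.mulVec_zero _) ?_
      · refine ((hx t).mulVec (A - algebraMap ℂ _ z)).congr_deriv ?_
        rw [Matrix.mulVec_add, Matrix.mulVec_mulVec, Matrix.mulVec_mulVec, sub_mul, mul_sub,
          Algebra.commutes]
      · rw [Multiset.map_cons, Multiset.prod_cons, mul_comm] at h
        simpa [Matrix.mulVec_mulVec] using h
    refine tendsto_zero_of_hasDerivAt_smul (hs z (Multiset.mem_cons_self z s))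
      (e := fun t => (A - algebraMap ℂ _ z) *ᵥ x t + e t) (fun t => ?_) (by simpa using h1.add he)
    refine (hx t).congr_deriv ?_
    rw [← add_assoc, Matrix.sub_mulVec, Matrix.algebraMap_eq_diagonal]
    congr 1
    ext i
    simp [Matrix.mulVec_diagonal]

theorem IsHurwitz.tendsto_zero {X : Type} [Fintype X] [DecidableEq X] {A : Matrix X X ℝ}
    (hA : IsHurwitz A) {e x : ℝ → X → ℝ} (h : IsTrajectory A 1 e x)
    (he : Tendsto e atTop (𝓝 0)) : Tendsto x atTop (𝓝 0) := by
  obtain ⟨z, e', hz, he', hxz⟩ := h.exists_hasDerivAt_approx he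
  suffices Tendsto z atTop (𝓝 0) by simpa using hxz.add this
  set M := A.map Complex.ofReal with hM
  let J : (X → ℝ) →L[ℝ] (X → ℂ) := ContinuousLinearMap.pi fun i =>
    Complex.ofRealCLM.comp (ContinuousLinearMap.proj i)
  have hJ : ∀ v i, J v i = (v i : ℂ) := fun v i => rfl
  have hJA : ∀ v, J (A *ᵥ v) = M *ᵥ J v := fun v => by
    ext i; simp [hJ, Matrix.mulVec, dotProduct, hM]
  have hzC : Tendsto (fun t => J (z t)) atTop (𝓝 0) := by
    refine tendsto_zero_of_aeval_prod M M.charpoly.roots (fun w hw => hA w ?_) _ (fun t => J (e' t))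
      (fun t => ?_) (by simpa [Function.comp_def] using (J.continuous.tendsto 0).comp he') ?_
    · rw [Matrix.mem_spectrum_iff_isRoot_charpoly]
      exact Polynomial.isRoot_of_mem_roots hw
    · rw [← hJA, ← map_add]
      exact J.hasFDerivAt.comp_hasDerivAt t (hz t)
    -- By Cayley–Hamilton the product over all eigenvalues annihilates the state.
    · rw [← (IsAlgClosed.splits M.charpoly).eq_prod_roots_of_monic M.charpoly_monic,
        Matrix.aeval_self_charpoly]
      simp
  rw [tendsto_pi_nhds] at hzC ⊢
  intro i
  simpa [hJ, Function.comp_def] using (Complex.continuous_re.tendsto 0).comp (hzC i)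

/-- Uniqueness for a linear ODE, applied to the differentiable primitive that agrees with `x` on
`[0, ∞)`. -/
theorem IsTrajectory.eq_zero_of_free {X U : Type} [Fintype X] [Fintype U] {A : Matrix X X ℝ}
    {u : ℝ → U → ℝ} {x : ℝ → X → ℝ} (h : IsTrajectory A 0 u x) (h0 : x 0 = 0) :
    ∀ t, 0 ≤ t → x t = 0 := by
  let x₁ : ℝ → X → ℝ := fun t => x (max t 0)
  have hx₁ : Continuous x₁ := h.continuousOn.comp_continuous (by fun_prop) (fun t => le_max_right t 0)
  let I : ℝ → X → ℝ := fun t => ∫ s in (0 : ℝ)..t, A *ᵥ x₁ s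
  have hI : ∀ t, HasDerivAt I (A *ᵥ x₁ t) t := fun t =>
    ((by fun_prop : Continuous fun s => A *ᵥ x₁ s).integral_hasStrictDerivAt 0 t).hasDerivAt
  have hxI : ∀ t, 0 ≤ t → x t = I t := fun t ht => by
    rw [h.eq_integral t ht, h0, zero_add]
    refine intervalIntegral.integral_congr fun s hs => ?_
    rw [Set.uIcc_of_le ht] at hs
    simp [x₁, max_eq_left hs.1]
  intro t ht
  rw [hxI t ht]
  refine ODE_solution_unique (v := fun _ y => A *ᵥ y) (f := I) (g := fun _ => 0) (a := 0) (b := t)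
    (fun _ => A.mulVecLin.toContinuousLinearMap.lipschitz)
    (fun s _ => (hI s).continuousAt.continuousWithinAt) (fun s hs => ?_)
    continuousOn_const (fun s _ => by simpa using hasDerivWithinAt_const s _ (0 : X → ℝ))
    (by simp [I]) ⟨ht, le_rfl⟩
  have h1 := (hI s).hasDerivWithinAt (s := Set.Ici s)
  rwa [show x₁ s = I s by rw [← hxI s hs.1]; simp [x₁, max_eq_left hs.1]] at h1

/-! ### Integrator chains. -/

section chains

variable {r : ℕ} {q : Fin r → ℕ}

theorem chainShift_mulVec {R : Type*} [NonAssocSemiring R] (f : ℝ →+* R) (v : (Σ i, Fin (q i)) → R)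
    (s : Σ i, Fin (q i)) :
    ((chainShift q).map f *ᵥ v) s =
      if h : (s.2 : ℕ) + 1 < q s.1 then v ⟨s.1, ⟨(s.2 : ℕ) + 1, h⟩⟩ else 0 := by
  obtain ⟨i, j⟩ := s
  simp only [Matrix.mulVec, dotProduct, Matrix.map_apply, chainShift, Fintype.sum_sigma]
  rw [Finset.sum_eq_single i]
  · simp only [Matrix.blockDiagonal'_apply_eq, jordanBlock, Matrix.of_apply]
    split_ifs with h
    · rw [Finset.sum_eq_single ⟨(j : ℕ) + 1, h⟩]
      · simp
      · intro b _ hb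
        have : ¬ (j : ℕ) + 1 = b := fun h => hb (Fin.ext h.symm)
        simp [this]
      · simp
    · refine Finset.sum_eq_zero fun b _ => ?_
      have : ¬ (j : ℕ) + 1 = b := fun h' => h (h' ▸ b.2)
      simp [this]
  · intro k _ hk
    refine Finset.sum_eq_zero fun b _ => ?_
    rw [Matrix.blockDiagonal'_apply_ne _ _ _ (Ne.symm hk)]
    simp
  · simp

theorem chainShift_mulVec_real (v : (Σ i, Fin (q i)) → ℝ) (s : Σ i, Fin (q i)) :
    (chainShift q *ᵥ v) s =
      if h : (s.2 : ℕ) + 1 < q s.1 then v ⟨s.1, ⟨(s.2 : ℕ) + 1, h⟩⟩ else 0 := by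
  simpa using chainShift_mulVec (RingHom.id ℝ) v s

theorem chainOutput_mulVec {R : Type*} [NonAssocSemiring R] (f : ℝ →+* R) (hq : ∀ i, 0 < q i)
    (v : (Σ i, Fin (q i)) → R) (i : Fin r) :
    ((chainOutput q).map f *ᵥ v) i = v ⟨i, ⟨0, hq i⟩⟩ := by
  simp only [Matrix.mulVec, dotProduct, Matrix.map_apply, chainOutput, Matrix.of_apply]
  rw [Finset.sum_eq_single ⟨i, ⟨0, hq i⟩⟩]
  · simp
  · rintro ⟨k, b⟩ _ hb
    have : ¬ (k = i ∧ (b : ℕ) = 0) := by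
      rintro ⟨rfl, h⟩
      exact hb (by congr; exact Fin.ext h)
    simp [this]
  · simp

theorem chainOutput_mulVec_real (hq : ∀ i, 0 < q i) (v : (Σ i, Fin (q i)) → ℝ) (i : Fin r) :
    (chainOutput q *ᵥ v) i = v ⟨i, ⟨0, hq i⟩⟩ := by
  simpa using chainOutput_mulVec (RingHom.id ℝ) hq v i

theorem chainInput_mulVec (v : Fin r → ℝ) (s : Σ i, Fin (q i)) :
    (chainInput q *ᵥ v) s = if (s.2 : ℕ) + 1 = q s.1 then v s.1 else 0 := by
  simp only [Matrix.mulVec, dotProduct, chainInput, Matrix.of_apply]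
  rw [Finset.sum_eq_single s.1]
  · simp
  · intro k _ hk
    simp [Ne.symm hk]
  · simp

/-- Once a state of a chain vanishes identically, its integral equation says that the next state has
zero integrals. Forcing is therefore allowed in the last state of each chain, which is where the
input `u_d` enters. -/
theorem IsTrajectory.chain_eq_zero {e x : ℝ → (Σ i, Fin (q i)) → ℝ}
    (h : IsTrajectory (chainShift q) 1 e x) (hq : ∀ i, 0 < q i)
    (hy : ∀ t, 0 ≤ t → chainOutput q *ᵥ x t = 0)
    (he : ∀ t, 0 ≤ t → ∀ s : Σ i, Fin (q i), (s.2 : ℕ) + 1 < q s.1 → e t s = 0) :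
    ∀ t, 0 ≤ t → x t = 0 := by
  have key : ∀ (m : ℕ) (i : Fin r) (hm : m < q i) (t : ℝ), 0 ≤ t → x t ⟨i, ⟨m, hm⟩⟩ = 0 := by
    intro m
    induction m with
    | zero =>
      intro i hm t ht
      have h1 := congrFun (hy t ht) i
      rwa [chainOutput_mulVec_real hq] at h1
    | succ m ih =>
      intro i hm
      refine eq_zero_of_integral_eq_zero ((continuousOn_pi.1 h.continuousOn) _) fun t ht => ?_
      have h1 := (ContinuousLinearMap.proj (R := ℝ) (φ := fun _ : (Σ i, Fin (q i)) => ℝ)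
        ⟨i, ⟨m, by omega⟩⟩).intervalIntegral_comp_comm (h.intervalIntegrable_rhs ht)
      have h2 := congrFun (h.eq_integral t ht) ⟨i, ⟨m, by omega⟩⟩
      rw [Pi.add_apply, ih, ih _ _ _ le_rfl, zero_add] at h2
      · refine Eq.trans (intervalIntegral.integral_congr fun s hs => ?_) (h1.trans h2.symm)
        rw [Set.uIcc_of_le ht] at hs
        simp [chainShift_mulVec_real, hm, he s hs.1 ⟨i, ⟨m, by omega⟩⟩ hm]
      · exact ht
  intro t ht
  ext ⟨i, j⟩
  exact key j i j.2 t ht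

/-- An output injection placing all eigenvalues of the chains at `-1`. -/
def chainGain {r : ℕ} (q : Fin r → ℕ) : Matrix (Σ i, Fin (q i)) (Fin r) ℝ :=
  Matrix.of fun s i => if s.1 = i then ((q i).choose (s.2 + 1) : ℝ) else 0

theorem chainGain_mulVec {R : Type*} [NonAssocSemiring R] (f : ℝ →+* R) (v : Fin r → R)
    (s : Σ i, Fin (q i)) :
    ((chainGain q).map f *ᵥ v) s = ((q s.1).choose (s.2 + 1) : R) * v s.1 := by
  simp only [Matrix.mulVec, dotProduct, chainGain, Matrix.map_apply, Matrix.of_apply]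
  rw [Finset.sum_eq_single s.1]
  · simp
  · intro k _ hk
    simp [Ne.symm hk]
  · simp

theorem exists_mulVec_eq_smul_of_mem_spectrum {X : Type*} [Fintype X] [DecidableEq X]
    {A : Matrix X X ℂ} {z : ℂ} (hz : z ∈ spectrum ℂ A) : ∃ v, v ≠ 0 ∧ A *ᵥ v = z • v := by
  rw [spectrum.mem_iff, Matrix.isUnit_iff_isUnit_det, isUnit_iff_ne_zero, not_not] at hz
  obtain ⟨v, hv, h⟩ := Matrix.exists_mulVec_eq_zero_iff.2 hz
  refine ⟨v, hv, ?_⟩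
  rw [Matrix.sub_mulVec, sub_eq_zero, Matrix.algebraMap_eq_diagonal] at h
  rw [← h]
  ext i
  simp [Matrix.mulVec_diagonal]

/-- An eigenvector is determined on each chain by its first entry. The rows of the eigenvalue
equation give Horner's scheme for `(z + 1) ^ q i`, and the last row makes this power vanish on any
chain whose first entry is nonzero. -/
theorem isHurwitz_chainShift_sub (hq : ∀ i, 0 < q i) :
    IsHurwitz (chainShift q - chainGain q * chainOutput q) := by
  intro z hz
  obtain ⟨v, hv, h⟩ := exists_mulVec_eq_smul_of_mem_spectrum hz
  have hmap : (chainShift q - chainGain q * chainOutput q).map Complex.ofReal =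
      (chainShift q).map Complex.ofRealHom -
        (chainGain q).map Complex.ofRealHom * (chainOutput q).map Complex.ofRealHom := by
    rw [← Matrix.map_mul]
    ext i j
    simp only [Matrix.map_apply, Matrix.sub_apply, Complex.ofRealHom_eq_coe, Complex.ofReal_sub]
  rw [hmap, Matrix.sub_mulVec, ← Matrix.mulVec_mulVec] at h
  have hs : ∀ s : Σ i, Fin (q i), (if h : (s.2 : ℕ) + 1 < q s.1 then v ⟨s.1, ⟨(s.2 : ℕ) + 1, h⟩⟩ else 0)
      = z * v s + ((q s.1).choose (s.2 + 1) : ℂ) * v ⟨s.1, ⟨0, hq s.1⟩⟩ := fun s => by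
    have := congrFun h s
    rw [Pi.sub_apply, chainShift_mulVec, chainGain_mulVec, chainOutput_mulVec _ hq] at this
    rw [sub_eq_iff_eq_add.1 this]; simp
  have hform : ∀ (i : Fin r) (m : ℕ) (hm : m < q i), v ⟨i, ⟨m, hm⟩⟩ =
      (∑ k ∈ Finset.range (m + 1), z ^ (m - k) * ((q i).choose k : ℂ)) * v ⟨i, ⟨0, hq i⟩⟩ := by
    intro i m
    induction m with
    | zero => intro _; simp
    | succ m ih =>
      intro hm
      have := hs ⟨i, ⟨m, by omega⟩⟩
      simp only [hm, dif_pos] at this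
      rw [this, ih, Finset.sum_range_succ _ (m + 1)]
      have h2 : ∑ k ∈ Finset.range (m + 1), z ^ (m + 1 - k) * ((q i).choose k : ℂ) =
          z * ∑ k ∈ Finset.range (m + 1), z ^ (m - k) * ((q i).choose k : ℂ) := by
        rw [Finset.mul_sum]
        refine Finset.sum_congr rfl fun k hk => ?_
        rw [Nat.succ_sub (by simpa [Nat.lt_succ_iff] using hk), pow_succ]; ring
      rw [h2]; simp; ring
  obtain ⟨i, hi⟩ : ∃ i, v ⟨i, ⟨0, hq i⟩⟩ ≠ 0 := by
    by_contra! hc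
    exact hv (by ext ⟨i, j⟩; rw [← Fin.eta j j.2, hform, hc]; simp)
  obtain ⟨m, hm⟩ : ∃ m, q i = m + 1 := ⟨q i - 1, by have := hq i; omega⟩
  have h0 := hs ⟨i, ⟨m, by omega⟩⟩
  simp only [hm, lt_irrefl, dif_neg, not_false_eq_true] at h0
  rw [hform i m (by omega)] at h0
  generalize v ⟨i, ⟨0, hq i⟩⟩ = c at h0 hi
  rw [hm] at h0
  have h1 : (z + 1) ^ (m + 1) = 0 := by
    refine (mul_eq_zero.1 ?_).resolve_right hi
    rw [h0, add_comm z 1, add_pow, Finset.sum_range_succ _ (m + 1), add_mul, ← mul_assoc,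
      Finset.mul_sum]
    congr 2
    · refine Finset.sum_congr rfl fun k hk => ?_
      rw [Nat.succ_sub (by simpa [Nat.lt_succ_iff] using hk), pow_succ]; ring
    · simp
  have h2 : z = -1 := eq_neg_of_add_eq_zero_left (pow_eq_zero_iff (by omega) |>.1 h1)
  simp [h2]

end chains

/-! ### Oscillating signals and responses that stay small. -/

section oscillation

/-- The polynomials `P i` with `dⁱ/dtⁱ (e^{-Nt} e^{i e^t}) = e^{-Nt} (P i)(e^t) e^{i e^t}`. -/
noncomputable def oscPoly (N : ℕ) : ℕ → Polynomial ℂ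
  | 0 => 1
  | i + 1 => -(N : Polynomial ℂ) * oscPoly N i + Polynomial.X * (oscPoly N i).derivative +
      Polynomial.C Complex.I * (Polynomial.X * oscPoly N i)

theorem natDegree_oscPoly_le (N i : ℕ) : (oscPoly N i).natDegree ≤ i := by
  induction i with
  | zero => simp [oscPoly]
  | succ i ih =>
    rw [oscPoly]
    refine Polynomial.natDegree_add_le_of_degree_le (Polynomial.natDegree_add_le_of_degree_le ?_ ?_) ?_
    · refine Polynomial.natDegree_mul_le.trans ?_
      simp; omega
    · refine Polynomial.natDegree_mul_le.trans ?_
      have := Polynomial.natDegree_derivative_le (oscPoly N i)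
      simp; omega
    · refine (Polynomial.natDegree_C_mul_le _ _).trans (Polynomial.natDegree_mul_le.trans ?_)
      simp; omega

theorem coeff_oscPoly_self (N i : ℕ) : (oscPoly N i).coeff i = Complex.I ^ i := by
  induction i with
  | zero => simp [oscPoly]
  | succ i ih =>
    have h : (oscPoly N i).natDegree < i + 1 := Nat.lt_succ_of_le (natDegree_oscPoly_le N i)
    have h1 : (oscPoly N i).coeff (i + 1) = 0 := Polynomial.coeff_eq_zero_of_natDegree_lt h
    have h2 : (-(N : Polynomial ℂ) * oscPoly N i).coeff (i + 1) = 0 := by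
      rw [← Polynomial.C_eq_natCast, neg_mul, Polynomial.coeff_neg, Polynomial.coeff_C_mul, h1]; simp
    rw [oscPoly, Polynomial.coeff_add, Polynomial.coeff_add, h2, Polynomial.coeff_X_mul,
      Polynomial.coeff_C_mul, Polynomial.coeff_X_mul, Polynomial.coeff_derivative, h1, ih]
    ring

/-- Takes the real part of `e^{-Nt} e^{i e^t}`: each derivative gains at most a factor `e^t`, so
decay persists below order `N`, while at order `N` the leading term is `I ^ N e^{i e^t}`, of modulus
one. -/
theorem exists_oscillation (N : ℕ) : ∃ g : ℕ → ℝ → ℝ,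
    (∀ i t, HasDerivAt (g i) (g (i + 1) t) t) ∧ (∀ i < N, Tendsto (g i) atTop (𝓝 0)) ∧
      ¬ Tendsto (g N) atTop (𝓝 0) := by
  let w : ℝ → ℂ := fun t => Complex.exp (Complex.I * Complex.exp t)
  let G : ℕ → ℝ → ℂ := fun i t =>
    Complex.exp (-N * t) * (oscPoly N i).eval (Complex.exp t) * w t
  have hexp : ∀ t : ℝ, HasDerivAt (fun s : ℝ => Complex.exp s) (Complex.exp t) t := fun t =>
    (Complex.hasDerivAt_exp (t : ℂ)).comp_ofReal
  have hG : ∀ i t, HasDerivAt (G i) (G (i + 1) t) t := fun i t => by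
    have h1 : HasDerivAt (fun s : ℝ => Complex.exp (-N * s)) (Complex.exp (-N * t) * (-N)) t := by
      simpa using ((hasDerivAt_id (t : ℂ)).const_mul (-N : ℂ)).cexp.comp_ofReal
    have h2 : HasDerivAt (fun s : ℝ => (oscPoly N i).eval (Complex.exp s))
        ((oscPoly N i).derivative.eval (Complex.exp t) * Complex.exp t) t :=
      ((oscPoly N i).hasDerivAt (Complex.exp t)).comp_of_eq t (hexp t) rfl
    have h3 : HasDerivAt w (w t * (Complex.I * Complex.exp t)) t :=
      ((hexp t).const_mul Complex.I).cexp
    refine ((h1.mul h2).mul h3).congr_deriv ?_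
    simp only [G, oscPoly, Pi.mul_apply, Polynomial.eval_add, Polynomial.eval_mul, Polynomial.eval_neg,
      Polynomial.eval_natCast, Polynomial.eval_X, Polynomial.eval_C]
    ring
  have hw : ∀ t, ‖w t‖ = 1 := fun t => by
    simp only [w]
    rw [← Complex.ofReal_exp, mul_comm, Complex.norm_exp_ofReal_mul_I]
  have hlow : ∀ c : ℕ → ℂ, Tendsto (fun t : ℝ => Complex.exp (-N * t) *
      (∑ k ∈ Finset.range N, c k * Complex.exp t ^ k) * w t) atTop (𝓝 0) := fun c => by
    refine tendsto_zero_iff_norm_tendsto_zero.2 ?_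
    simp only [norm_mul, hw, mul_one]
    simp only [← norm_mul]
    refine tendsto_zero_iff_norm_tendsto_zero.1 ?_
    simp only [Finset.mul_sum]
    rw [show (0 : ℂ) = ∑ k ∈ Finset.range N, 0 by simp]
    refine tendsto_finsetSum _ fun k hk => ?_
    refine tendsto_zero_iff_norm_tendsto_zero.2 ?_
    have hk' : (k : ℝ) < N := by exact_mod_cast Finset.mem_range.1 hk
    have h1 : Tendsto (fun t : ℝ => ‖c k‖ * Real.exp (-((N - k : ℝ) * t))) atTop (𝓝 0) := by
      have := Real.tendsto_exp_neg_atTop_nhds_zero.comp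
        (tendsto_id.const_mul_atTop (sub_pos.2 hk'))
      simpa [Function.comp_def] using this.const_mul ‖c k‖
    refine h1.congr fun t => ?_
    rw [mul_left_comm, norm_mul, ← Complex.exp_nat_mul, ← Complex.exp_add, Complex.norm_exp]
    congr 2
    simp; ring
  have hGlow : ∀ i < N, Tendsto (G i) atTop (𝓝 0) := fun i hi => by
    refine (hlow (oscPoly N i).coeff).congr fun t => ?_
    simp only [G]
    rw [Polynomial.eval_eq_sum_range' ((natDegree_oscPoly_le N i).trans_lt hi)]
  refine ⟨fun i t => (G i t).re, fun i t => ?_, fun i hi => ?_, fun h => ?_⟩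
  · exact Complex.reCLM.hasFDerivAt.comp_hasDerivAt t (hG i t)
  · simpa [Function.comp_def] using (Complex.continuous_re.tendsto 0).comp (hGlow i hi)
  · have hdiff := (Complex.continuous_re.tendsto 0).comp (hlow (oscPoly N N).coeff)
    have h1 := h.sub hdiff
    -- At these times the phase `e^τ` is `3Nπ/2` modulo `2π`, so `w = (-I) ^ N` cancels the leading
    -- coefficient `I ^ N` and the top term is exactly `1`. The shift `m + 1` keeps the logarithm's
    -- argument positive even for `N = 0`.
    let τ : ℕ → ℝ := fun m => Real.log (2 * Real.pi * (m + 1 : ℕ) + 3 * N * (Real.pi / 2))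
    have hτ : Tendsto τ atTop atTop := by
      refine Real.tendsto_log_atTop.comp (tendsto_atTop_add_const_right _ _ ?_)
      refine Tendsto.const_mul_atTop (by positivity) ?_
      exact tendsto_natCast_atTop_atTop.comp (tendsto_add_atTop_nat 1)
    have h2 := h1.comp hτ
    have h3 : ∀ m, (G N (τ m)).re - (Complex.exp (-N * τ m) *
        (∑ k ∈ Finset.range N, (oscPoly N N).coeff k * Complex.exp (τ m) ^ k) * w (τ m)).re = 1 := by
      intro m
      have hp : 0 < 2 * Real.pi * (m + 1 : ℕ) + 3 * N * (Real.pi / 2) := by positivity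
      have he : Complex.exp (τ m) = ((2 * Real.pi * (m + 1 : ℕ) + 3 * N * (Real.pi / 2) : ℝ) : ℂ) := by
        rw [← Complex.ofReal_exp, Real.exp_log hp]
      have h4 : Complex.exp (-N * τ m) * Complex.exp (τ m) ^ N = 1 := by
        rw [← Complex.exp_nat_mul, ← Complex.exp_add]; simp
      have h5 : w (τ m) = (-Complex.I) ^ N := by
        simp only [w, he]
        rw [show Complex.I * ((2 * Real.pi * (m + 1 : ℕ) + 3 * N * (Real.pi / 2) : ℝ) : ℂ) =
          (m + 1 : ℕ) * (2 * Real.pi * Complex.I) + N * (Real.pi * Complex.I) +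
            N * (Real.pi / 2 * Complex.I) by push_cast; ring, Complex.exp_add, Complex.exp_add,
          Complex.exp_nat_mul_two_pi_mul_I, Complex.exp_nat_mul, Complex.exp_nat_mul,
          Complex.exp_pi_mul_I, Complex.exp_pi_div_two_mul_I, one_mul, ← mul_pow]
        simp
      rw [← Complex.sub_re, ← sub_mul, ← mul_sub]
      rw [Polynomial.eval_eq_sum_range' (Nat.lt_succ_of_le (natDegree_oscPoly_le N N)),
        Finset.sum_range_succ, add_sub_cancel_left, coeff_oscPoly_self, mul_left_comm, h4, h5,
        mul_one, ← mul_pow]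
      simp
    have h6 := h2.congr h3
    simpa using tendsto_nhds_unique tendsto_const_nhds h6

end oscillation

theorem exists_oscillating_response {X : Type} [Fintype X] [DecidableEq X] (M : Matrix X X ℝ)
    (h : X → ℝ) : ∃ (x : ℝ → X → ℝ) (f : ℕ → ℝ → ℝ), (∀ i t, HasDerivAt (f i) (f (i + 1) t) t) ∧
      (∀ t, HasDerivAt x (M *ᵥ x t + f 0 t • h) t) ∧ Tendsto x atTop (𝓝 0) ∧
      Tendsto (f 0) atTop (𝓝 0) ∧ ¬ Tendsto (f 1) atTop (𝓝 0) := by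
  set k := M.charpoly.natDegree with hk
  -- With order `k + 1`, the derivatives of `g` up to order `k` decay, hence so does `f = p(d/dt)
  -- g`; as `p` is monic, `f'` contains the non-decaying `g^(k+1)` with coefficient `1`.
  obtain ⟨g, hg, hg0, hg1⟩ := exists_oscillation (k + 1)
  let c : ℕ → ℝ := M.charpoly.coeff
  -- This is `(sⁱ - Mⁱ)/(s - M)` with `s = d/dt`, applied to `g h`: the response to `g^(i) h` up to
  -- the defect `g Mⁱ h`. Weighted by the coefficients of `p`, the defects sum to `g p(M) h = 0`.
  let x : ℕ → ℝ → X → ℝ := fun i t => ∑ j ∈ Finset.range i, g j t • (M ^ (i - 1 - j) *ᵥ h)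
  have hx : ∀ i t, HasDerivAt (x i) (M *ᵥ x i t + g i t • h - g 0 t • (M ^ i *ᵥ h)) t := fun i t => by
    have h1 : HasDerivAt (x i) (∑ j ∈ Finset.range i, g (j + 1) t • (M ^ (i - 1 - j) *ᵥ h)) t :=
      HasDerivAt.fun_sum fun j _ => (hg j t).smul_const _
    refine h1.congr_deriv ?_
    have h2 : M *ᵥ x i t = ∑ j ∈ Finset.range i, g j t • (M ^ (i - j) *ᵥ h) := by
      simp only [x, Matrix.mulVec_sum, Matrix.mulVec_smul, Matrix.mulVec_mulVec, ← pow_succ']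
      refine Finset.sum_congr rfl fun j hj => ?_
      rw [Finset.mem_range] at hj
      rw [show i - 1 - j + 1 = i - j by omega]
    have h3 := Finset.sum_range_sub (fun j => g j t • (M ^ (i - j) *ᵥ h)) i
    simp only [Nat.sub_self, pow_zero, Matrix.one_mulVec, Nat.sub_zero] at h3
    rw [h2, add_sub_assoc, ← h3, Finset.sum_sub_distrib, add_sub_cancel]
    refine Finset.sum_congr rfl fun j _ => ?_
    rw [show i - 1 - j = i - (j + 1) by omega]
  have hsum : ∑ i ∈ Finset.range (k + 1), c i • (M ^ i *ᵥ h) = 0 := by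
    have := M.aeval_self_charpoly
    rw [Polynomial.aeval_eq_sum_range, ← hk] at this
    simpa only [Matrix.zero_mulVec, Matrix.sum_mulVec, Matrix.smul_mulVec] using congrArg (· *ᵥ h) this
  have hxlim : ∀ i, i ≤ k → Tendsto (x i) atTop (𝓝 0) := fun i hi => by
    rw [show (0 : X → ℝ) = ∑ j ∈ Finset.range i, (0 : ℝ) • (M ^ (i - 1 - j) *ᵥ h) by simp]
    refine tendsto_finsetSum _ fun j hj => ?_
    exact (hg0 j (by have := Finset.mem_range.1 hj; omega)).smul_const _
  refine ⟨fun t => ∑ i ∈ Finset.range (k + 1), c i • x i t,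
    fun r t => ∑ i ∈ Finset.range (k + 1), c i * g (i + r) t, fun r t => ?_, fun t => ?_, ?_, ?_, ?_⟩
  · exact HasDerivAt.fun_sum fun i _ => (hg (i + r) t).const_mul (c i)
  · refine (HasDerivAt.fun_sum fun i _ => (hx i t).const_smul (c i)).congr_deriv ?_
    simp only [Matrix.mulVec_sum, Matrix.mulVec_smul, smul_sub, smul_add, Finset.sum_sub_distrib,
      Finset.sum_add_distrib, add_zero, Finset.sum_smul, mul_smul]
    rw [sub_eq_self]
    simp_rw [smul_comm (c _) (g 0 t)]
    rw [← Finset.smul_sum, hsum, smul_zero]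
  · rw [show (0 : X → ℝ) = ∑ i ∈ Finset.range (k + 1), c i • (0 : X → ℝ) by simp]
    exact tendsto_finsetSum _ fun i hi => (hxlim i (by have := Finset.mem_range.1 hi; omega)).const_smul _
  · rw [show (0 : ℝ) = ∑ i ∈ Finset.range (k + 1), c i * 0 by simp]
    exact tendsto_finsetSum _ fun i hi => (hg0 i (Finset.mem_range.1 hi)).const_mul _
  · intro hf
    have h1 : Tendsto (fun t => ∑ i ∈ Finset.range k, c i * g (i + 1) t) atTop (𝓝 0) := by
      rw [show (0 : ℝ) = ∑ i ∈ Finset.range k, c i * 0 by simp]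
      exact tendsto_finsetSum _ fun i hi =>
        (hg0 _ (by have := Finset.mem_range.1 hi; omega)).const_mul _
    have hck : c k = 1 := M.charpoly_monic
    refine hg1 ((sub_zero (0 : ℝ) ▸ hf.sub h1).congr fun t => ?_)
    beta_reduce
    rw [Finset.sum_range_succ, hck]; ring

/-! ### The rank condition as a kernel condition. -/

/-- Projecting the kernel of the block matrix to its first component has kernel a copy of `ker D`,
so by rank–nullity the rank is `rank D + card U` minus the dimension of the image. -/
theorem Matrix.rank_fromBlocks_eq_rank_add_card_iff {U Y : Type*} [Fintype U] [Fintype Y]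
    (K D : Matrix Y U ℝ) : (Matrix.fromBlocks K D D 0).rank = D.rank + Fintype.card U ↔
      ∀ v, D *ᵥ v = 0 → (∃ w, K *ᵥ v = D *ᵥ w) → v = 0 := by
  have hmem : ∀ v, v ∈ LinearMap.ker (Matrix.fromBlocks K D D 0).mulVecLin ↔
      K *ᵥ (v ∘ Sum.inl) + D *ᵥ (v ∘ Sum.inr) = 0 ∧ D *ᵥ (v ∘ Sum.inl) = 0 := fun v => by
    rw [LinearMap.mem_ker, Matrix.mulVecLin_apply, Matrix.fromBlocks_mulVec, ← Sum.elim_zero_zero,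
      Sum.elim_eq_iff]
    simp
  have h1 := (Matrix.fromBlocks K D D 0).mulVecLin.finrank_range_add_finrank_ker
  have h2 := D.mulVecLin.finrank_range_add_finrank_ker
  let π : LinearMap.ker (Matrix.fromBlocks K D D 0).mulVecLin →ₗ[ℝ] (U → ℝ) :=
    (LinearMap.funLeft ℝ ℝ Sum.inl).comp (Submodule.subtype _)
  have hπ : ∀ v, π v = (v : U ⊕ U → ℝ) ∘ Sum.inl := fun v => rfl
  let ι : LinearMap.ker D.mulVecLin →ₗ[ℝ] LinearMap.ker (Matrix.fromBlocks K D D 0).mulVecLin :=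
    { toFun := fun w => ⟨Sum.elim (0 : U → ℝ) (w : U → ℝ), (hmem _).2 ⟨by
        have := w.2
        rw [LinearMap.mem_ker, Matrix.mulVecLin_apply] at this
        simp [this], by rw [Sum.elim_comp_inl, Matrix.mulVec_zero]⟩⟩
      map_add' := fun a b => by ext (i | i) <;> simp
      map_smul' := fun c a => by ext (i | i) <;> simp }
  have hι : ∀ w, (ι w : U ⊕ U → ℝ) = Sum.elim (0 : U → ℝ) (w : U → ℝ) := fun w => rfl
  have hιinj : Function.Injective ι := fun a b hab => by
    ext i
    have := congrFun (congrArg Subtype.val hab) (Sum.inr i)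
    simpa [hι] using this
  have hker : LinearMap.ker π = LinearMap.range ι := by
    ext v
    rw [LinearMap.mem_ker, LinearMap.mem_range, hπ]
    constructor
    · intro hv
      refine ⟨⟨(v : U ⊕ U → ℝ) ∘ Sum.inr, ?_⟩, ?_⟩
      · have := ((hmem v).1 v.2).1
        rw [hv, Matrix.mulVec_zero, zero_add] at this
        exact this
      · ext (i | i)
        · simpa [hι] using (congrFun hv i).symm
        · simp [hι]
    · rintro ⟨w, rfl⟩
      ext i; simp [hι]
  have h3 := π.finrank_range_add_finrank_ker
  rw [hker, LinearMap.finrank_range_of_inj hιinj] at h3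
  have h4 : (∀ v, D *ᵥ v = 0 → (∃ w, K *ᵥ v = D *ᵥ w) → v = 0) ↔ LinearMap.range π = ⊥ := by
    rw [LinearMap.range_eq_bot]
    constructor
    · intro h
      ext v : 1
      obtain ⟨ha, hb⟩ := (hmem v).1 v.2
      refine h _ hb ⟨-((v : U ⊕ U → ℝ) ∘ Sum.inr), ?_⟩
      rw [Matrix.mulVec_neg, eq_neg_iff_add_eq_zero]
      exact ha
    · rintro h v hv ⟨w, hw⟩
      have := LinearMap.congr_fun h ⟨Sum.elim v (-w), (hmem _).2
        ⟨by simp [hw, Matrix.mulVec_neg], by simpa using hv⟩⟩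
      simpa [hπ] using this
  rw [h4, ← Submodule.finrank_eq_zero (R := ℝ)]
  simp only [Module.finrank_fintype_fun_eq_card, Fintype.card_sum] at h1 h2
  unfold Matrix.rank
  omega

/-! ### Invariance under changes of coordinates. -/

namespace LTISystem

variable {X U Y X' U' Y' : Type}

section

variable [Fintype U]

/-- No nonzero input direction lies in the kernel of both `B` and `D`. -/
def InputInjective (S : LTISystem X U Y) : Prop := ∀ v, S.B *ᵥ v = 0 → S.D *ᵥ v = 0 → v = 0

/-- The kernel form of the observer rank condition. -/
def ObserverKernelCondition [Fintype X] (S : LTISystem X U Y) : Prop :=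
  ∀ v, S.D *ᵥ v = 0 → (∃ w, (S.C * S.B) *ᵥ v = S.D *ᵥ w) → v = 0

theorem inputInjective_of_rank {S : LTISystem X U Y}
    (h : (Matrix.fromRows S.B S.D).rank = Fintype.card U) : S.InputInjective := by
  intro v hB hD
  have h1 := (Matrix.fromRows S.B S.D).mulVecLin.finrank_range_add_finrank_ker
  rw [Module.finrank_fintype_fun_eq_card, ← h, Matrix.rank, Nat.add_eq_left,
    Submodule.finrank_eq_zero] at h1
  have h2 : v ∈ LinearMap.ker (Matrix.fromRows S.B S.D).mulVecLin := by
    rw [LinearMap.mem_ker, Matrix.mulVecLin_apply, Matrix.fromRows_mulVec, hB, hD,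
      Sum.elim_zero_zero]
  rwa [h1, Submodule.mem_bot] at h2

theorem observerRankCondition_iff [Fintype X] [Fintype Y] {S : LTISystem X U Y}
    (h : (Matrix.fromRows S.B S.D).rank = Fintype.card U) :
    S.ObserverRankCondition ↔ S.ObserverKernelCondition := by
  rw [ObserverRankCondition, h, Matrix.rank_fromBlocks_eq_rank_add_card_iff]
  simp [ObserverKernelCondition]

variable [Fintype X] [Fintype X'] [Fintype U']

theorem _root_.IsTrajectory.change_coordinates {A : Matrix X X ℝ} {B : Matrix X U ℝ}
    {A' : Matrix X' X' ℝ} {B' : Matrix X' U' ℝ} {Ts : Matrix X X' ℝ} {Ti : Matrix U U' ℝ}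
    (hA : A * Ts = Ts * A') (hB : B * Ti = Ts * B') {u : ℝ → U' → ℝ} {x : ℝ → X' → ℝ}
    (h : IsTrajectory A' B' u x) :
    IsTrajectory A B (fun t => Ti *ᵥ u t) (fun t => Ts *ᵥ x t) := by
  refine h.map Ts.mulVecLin.toContinuousLinearMap
    (fun t ht => (h.input_integrable t ht).mulVec Ti) fun t => ?_
  simp [Matrix.mulVec_add, Matrix.mulVec_mulVec, hA, hB]

theorem output_change_coordinates [Fintype Y'] {S : LTISystem X U Y} {S' : LTISystem X' U' Y'}
    {Ts : Matrix X X' ℝ} {Ti : Matrix U U' ℝ} {To : Matrix Y Y' ℝ}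
    (hC : S.C * Ts = To * S'.C) (hD : S.D * Ti = To * S'.D) (u : ℝ → U' → ℝ) (x : ℝ → X' → ℝ)
    (t : ℝ) : S.output (fun t => Ti *ᵥ u t) (fun t => Ts *ᵥ x t) t = To *ᵥ S'.output u x t := by
  simp [output, Matrix.mulVec_add, Matrix.mulVec_mulVec, hC, hD]

end

variable [Fintype X] [Fintype U] [Fintype Y] [Fintype X'] [Fintype U']
  [Fintype Y'] [DecidableEq X] [DecidableEq U] [DecidableEq Y] [DecidableEq X'] [DecidableEq U']
  [DecidableEq Y']

/-- Two systems which agree up to changes of coordinates. -/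
def Similar (S : LTISystem X U Y) (S' : LTISystem X' U' Y') : Prop :=
  ∃ (Ts : Matrix X X' ℝ) (Ti : Matrix U U' ℝ) (To : Matrix Y Y' ℝ),
    IsNonsingular Ts ∧ IsNonsingular Ti ∧ IsNonsingular To ∧
      S.A * Ts = Ts * S'.A ∧ S.B * Ti = Ts * S'.B ∧ S.C * Ts = To * S'.C ∧ S.D * Ti = To * S'.D

theorem SCB.similar {S : LTISystem X U Y} (scb : S.SCB) : S.Similar scb.form.toLTISystem :=
  ⟨scb.Ts, scb.Ti, scb.To, scb.Ts_nonsingular, scb.Ti_nonsingular, scb.To_nonsingular, scb.A_eq,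
    scb.B_eq, scb.C_eq, scb.D_eq⟩

theorem _root_.Matrix.mul_eq_mul_of_mul_eq_mul {Z W Z' W' : Type*} [Fintype Z] [Fintype W]
    [Fintype Z'] [Fintype W'] [DecidableEq Z] [DecidableEq W] [DecidableEq Z'] [DecidableEq W']
    {M : Matrix Z W ℝ} {M' : Matrix Z' W' ℝ} {T : Matrix W W' ℝ} {R : Matrix Z Z' ℝ}
    {T' : Matrix W' W ℝ} {R' : Matrix Z' Z ℝ} (hT : T * T' = 1) (hR : R' * R = 1)
    (h : M * T = R * M') : M' * T' = R' * M := by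
  calc M' * T' = R' * (R * M') * T' := by rw [← Matrix.mul_assoc R', hR, Matrix.one_mul]
    _ = R' * M := by rw [← h, Matrix.mul_assoc, Matrix.mul_assoc, hT, Matrix.mul_one]

theorem Similar.symm {S : LTISystem X U Y} {S' : LTISystem X' U' Y'} (h : S.Similar S') :
    S'.Similar S := by
  obtain ⟨Ts, Ti, To, ⟨Ts', hs, hs'⟩, ⟨Ti', hi, hi'⟩, ⟨To', ho, ho'⟩, hA, hB, hC, hD⟩ := h
  exact ⟨Ts', Ti', To', ⟨Ts, hs', hs⟩, ⟨Ti, hi', hi⟩, ⟨To, ho', ho⟩,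
    Matrix.mul_eq_mul_of_mul_eq_mul hs hs' hA, Matrix.mul_eq_mul_of_mul_eq_mul hi hs' hB,
    Matrix.mul_eq_mul_of_mul_eq_mul hs ho' hC, Matrix.mul_eq_mul_of_mul_eq_mul hi ho' hD⟩

theorem _root_.Matrix.mulVec_left_cancel {Z W : Type*} [Fintype Z] [Fintype W] [DecidableEq W]
    {T : Matrix Z W ℝ} {T' : Matrix W Z ℝ} (h : T' * T = 1) (v : W → ℝ) : T' *ᵥ (T *ᵥ v) = v := by
  rw [Matrix.mulVec_mulVec, h, Matrix.one_mulVec]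

theorem _root_.Filter.Tendsto.of_mulVec {Z W α : Type*} [Fintype Z] [Fintype W] [DecidableEq W]
    {T : Matrix Z W ℝ} {T' : Matrix W Z ℝ} (h : T' * T = 1) {l : Filter α} {x : α → W → ℝ}
    (hx : Tendsto (fun t => T *ᵥ x t) l (𝓝 0)) : Tendsto x l (𝓝 0) := by
  simpa [Matrix.mulVec_left_cancel h] using hx.mulVec_zero T'

theorem Similar.stronglyObservable {S : LTISystem X U Y} {S' : LTISystem X' U' Y'}
    (h : S.Similar S') (hS : S.StronglyObservable) : S'.StronglyObservable := by
  obtain ⟨Ts, Ti, To, ⟨Ts', hs, hs'⟩, -, -, hA, hB, hC, hD⟩ := h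
  intro u x hx hy t ht
  have := hS _ _ (hx.change_coordinates hA hB)
    (fun t ht => by rw [output_change_coordinates hC hD, hy t ht, Matrix.mulVec_zero]) t ht
  rw [← Matrix.mulVec_left_cancel hs' (x t), this, Matrix.mulVec_zero]

theorem Similar.stronglyDetectable {S : LTISystem X U Y} {S' : LTISystem X' U' Y'}
    (h : S.Similar S') (hS : S.StronglyDetectable) : S'.StronglyDetectable := by
  obtain ⟨Ts, Ti, To, ⟨Ts', hs, hs'⟩, -, -, hA, hB, hC, hD⟩ := h
  intro u x hx hy
  exact (hS _ _ (hx.change_coordinates hA hB)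
    (fun t ht => by rw [output_change_coordinates hC hD, hy t ht, Matrix.mulVec_zero])).of_mulVec hs'

theorem Similar.strongStarDetectable {S : LTISystem X U Y} {S' : LTISystem X' U' Y'}
    (h : S.Similar S') (hS : S.StrongStarDetectable) : S'.StrongStarDetectable := by
  obtain ⟨Ts, Ti, To, ⟨Ts', hs, hs'⟩, -, -, hA, hB, hC, hD⟩ := h
  intro u x hx hy
  refine (hS _ _ (hx.change_coordinates hA hB) ?_).of_mulVec hs'
  exact (hy.mulVec_zero To).congr fun t => (output_change_coordinates hC hD u x t).symm

theorem Similar.inputInjective {S : LTISystem X U Y} {S' : LTISystem X' U' Y'}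
    (h : S.Similar S') (hS : S.InputInjective) : S'.InputInjective := by
  obtain ⟨Ts, Ti, To, -, ⟨Ti', hi, hi'⟩, -, hA, hB, hC, hD⟩ := h
  intro v hBv hDv
  have := hS (Ti *ᵥ v) (by rw [Matrix.mulVec_mulVec, hB, ← Matrix.mulVec_mulVec, hBv, Matrix.mulVec_zero])
    (by rw [Matrix.mulVec_mulVec, hD, ← Matrix.mulVec_mulVec, hDv, Matrix.mulVec_zero])
  rw [← Matrix.mulVec_left_cancel hi' v, this, Matrix.mulVec_zero]

theorem Similar.observerKernelCondition {S : LTISystem X U Y} {S' : LTISystem X' U' Y'}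
    (h : S.Similar S') (hS : S.ObserverKernelCondition) : S'.ObserverKernelCondition := by
  obtain ⟨Ts, Ti, To, -, ⟨Ti', hi, hi'⟩, -, hA, hB, hC, hD⟩ := h
  rintro v hDv ⟨w, hw⟩
  have := hS (Ti *ᵥ v)
    (by rw [Matrix.mulVec_mulVec, hD, ← Matrix.mulVec_mulVec, hDv, Matrix.mulVec_zero])
    ⟨Ti *ᵥ w, by rw [Matrix.mulVec_mulVec, Matrix.mul_assoc, hB, ← Matrix.mul_assoc, hC,
      Matrix.mul_assoc, ← Matrix.mulVec_mulVec, hw, Matrix.mulVec_mulVec, Matrix.mulVec_mulVec, hD]⟩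
  rw [← Matrix.mulVec_left_cancel hi' v, this, Matrix.mulVec_zero]

end LTISystem

/-! ### Controllability and eigenmodes. -/

/-- The case `w = 0` makes `A` injective, hence surjective; then each `B w` is balanced by some `v`,
which must be zero, so `B = 0` and the origin cannot be left. -/
theorem IsControllablePair.isEmpty {X U : Type} [Fintype X] [Fintype U] {A : Matrix X X ℝ}
    {B : Matrix X U ℝ} (h : IsControllablePair A B)
    (heq : ∀ v w, A *ᵥ v + B *ᵥ w = 0 → v = 0) : IsEmpty X := by
  have hinj : Function.Injective A.mulVecLin :=
    (injective_iff_map_eq_zero _).2 fun v hv => heq v 0 (by simpa using hv)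
  have hB : B = 0 := by
    refine Matrix.ext_iff_mulVec.2 fun w => ?_
    obtain ⟨v, hv⟩ := LinearMap.surjective_of_injective hinj (-(B *ᵥ w))
    rw [Matrix.mulVecLin_apply] at hv
    have hv0 := heq v w (by rw [hv, neg_add_cancel])
    rw [hv0, Matrix.mulVec_zero, zero_eq_neg] at hv
    rw [hv, Matrix.zero_mulVec]
  subst hB
  by_contra hX
  rw [not_isEmpty_iff] at hX
  obtain ⟨T, u, x, hT, hx, h0, h1⟩ := h 0 1
  have := (hx.eq_zero_of_free h0) T hT.le
  rw [h1] at this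
  exact one_ne_zero this

/-- Real and imaginary parts of `exp (z t) v` for an eigenvector `v`. Either part may vanish at a
given time; the sum of squares does not. -/
theorem exists_mode_of_mem_spectrum {X : Type} [Fintype X] [DecidableEq X] {A : Matrix X X ℝ} {z : ℂ}
    (hz : z ∈ spectrum ℂ (A.map Complex.ofReal)) : ∃ x y : ℝ → X → ℝ,
      (∀ t, HasDerivAt x (A *ᵥ x t) t) ∧ (∀ t, HasDerivAt y (A *ᵥ y t) t) ∧
      ∃ i, ∃ c > 0, ∀ t, x t i ^ 2 + y t i ^ 2 = c * Real.exp (2 * z.re * t) := by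
  obtain ⟨v, hv, hAv⟩ := exists_mulVec_eq_smul_of_mem_spectrum hz
  obtain ⟨i, hi⟩ := Function.ne_iff.1 hv
  have hd : ∀ i (t : ℝ), HasDerivAt (fun s : ℝ => Complex.exp (z * s) * v i)
      (∑ j, (A i j : ℂ) * (Complex.exp (z * t) * v j)) t := fun i t => by
    have h1 : HasDerivAt (fun s : ℝ => Complex.exp (z * s)) (Complex.exp (z * t) * z) t := by
      simpa using ((hasDerivAt_id (t : ℂ)).const_mul z).cexp.comp_ofReal
    refine (h1.mul_const (v i)).congr_deriv ?_
    have := congrFun hAv i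
    simp only [Matrix.mulVec, dotProduct, Matrix.map_apply, Pi.smul_apply, smul_eq_mul] at this
    rw [mul_assoc, ← this, Finset.mul_sum]
    exact Finset.sum_congr rfl fun j _ => by ring
  refine ⟨fun t i => (Complex.exp (z * t) * v i).re, fun t i => (Complex.exp (z * t) * v i).im,
    fun t => hasDerivAt_pi.2 fun i => ?_, fun t => hasDerivAt_pi.2 fun i => ?_,
    i, ‖v i‖ ^ 2, pow_pos (norm_pos_iff.2 hi) 2, fun t => ?_⟩
  · refine (Complex.reCLM.hasFDerivAt.comp_hasDerivAt t (hd i t)).congr_deriv ?_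
    simp only [Complex.reCLM_apply, Complex.re_sum, Complex.re_ofReal_mul]; rfl
  · refine (Complex.imCLM.hasFDerivAt.comp_hasDerivAt t (hd i t)).congr_deriv ?_
    simp only [Complex.imCLM_apply, Complex.im_sum, Complex.im_ofReal_mul]; rfl
  · have h := Complex.sq_norm (Complex.exp (z * t) * v i)
    rw [Complex.normSq_apply, norm_mul, Complex.norm_exp, mul_pow, ← Real.exp_nat_mul] at h
    simp only [Complex.mul_re z, Complex.ofReal_re, Complex.ofReal_im, mul_zero, sub_zero] at h
    rw [mul_comm, pow_two, pow_two, ← h]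
    push_cast
    ring_nf

theorem LTISystem.StronglyObservable.stronglyDetectable {X U Y : Type} [Fintype X] [Fintype U]
    {S : LTISystem X U Y} (h : S.StronglyObservable) : S.StronglyDetectable := fun u x hx hy =>
  tendsto_const_nhds.congr' (by
    filter_upwards [eventually_ge_atTop 0] with t ht using (h u x hx hy t ht).symm)

theorem LTISystem.StrongStarDetectable.stronglyDetectable {X U Y : Type} [Fintype X] [Fintype U]
    {S : LTISystem X U Y} (h : S.StrongStarDetectable) : S.StronglyDetectable := fun u x hx hy =>
  h u x hx (tendsto_const_nhds.congr' (by
    filter_upwards [eventually_ge_atTop 0] with t ht using (hy t ht).symm))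

/-! ### The equations in special coordinates. -/

namespace SCBForm

variable (F : SCBForm)

/-- The state with the given blocks. -/
def mkState (xa : Fin F.na → ℝ) (xb : (Σ i, Fin (F.l i)) → ℝ) (xc : Fin F.nc → ℝ)
    (xd : (Σ i, Fin (F.q i)) → ℝ) : F.StateIdx → ℝ :=
  Sum.elim (Sum.elim xa xb) (Sum.elim xc xd)

/-- The block `x_a` of a state. -/
noncomputable def partA : (F.StateIdx → ℝ) →L[ℝ] (Fin F.na → ℝ) :=
  (LinearMap.funLeft ℝ ℝ fun i => Sum.inl (Sum.inl i)).toContinuousLinearMap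

/-- The block `x_b` of a state. -/
noncomputable def partB : (F.StateIdx → ℝ) →L[ℝ] ((Σ i, Fin (F.l i)) → ℝ) :=
  (LinearMap.funLeft ℝ ℝ fun i => Sum.inl (Sum.inr i)).toContinuousLinearMap

/-- The block `x_c` of a state. -/
noncomputable def partC : (F.StateIdx → ℝ) →L[ℝ] (Fin F.nc → ℝ) :=
  (LinearMap.funLeft ℝ ℝ fun i => Sum.inr (Sum.inl i)).toContinuousLinearMap

/-- The block `x_d` of a state. -/
noncomputable def partD : (F.StateIdx → ℝ) →L[ℝ] ((Σ i, Fin (F.q i)) → ℝ) :=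
  (LinearMap.funLeft ℝ ℝ fun i => Sum.inr (Sum.inr i)).toContinuousLinearMap

theorem mkState_parts (x : F.StateIdx → ℝ) :
    F.mkState (F.partA x) (F.partB x) (F.partC x) (F.partD x) = x := by
  ext ((i | i) | (i | i)) <;> rfl

section
variable (xa : Fin F.na → ℝ) (xb : (Σ i, Fin (F.l i)) → ℝ) (xc : Fin F.nc → ℝ)
    (xd : (Σ i, Fin (F.q i)) → ℝ)

theorem partA_mkState : F.partA (F.mkState xa xb xc xd) = xa := rfl
theorem partB_mkState : F.partB (F.mkState xa xb xc xd) = xb := rfl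
theorem partC_mkState : F.partC (F.mkState xa xb xc xd) = xc := rfl
theorem partD_mkState : F.partD (F.mkState xa xb xc xd) = xd := rfl

end

theorem C_mulVec (x : F.StateIdx → ℝ) : F.toLTISystem.C *ᵥ x =
    Sum.elim (F.C0 *ᵥ x) (Sum.elim (F.Cd *ᵥ F.partD x) (F.Cb *ᵥ F.partB x)) := by
  have hB : (x ∘ Sum.inl) ∘ Sum.inr = F.partB x := rfl
  have hD : (x ∘ Sum.inr) ∘ Sum.inr = F.partD x := rfl
  simp only [toLTISystem, Matrix.fromRows_mulVec, Matrix.fromCols_mulVec, Matrix.fromBlocks_mulVec,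
    hB, hD]
  ext (i | i | i) <;> simp

theorem D_mulVec (u : F.InputIdx → ℝ) : F.toLTISystem.D *ᵥ u = Sum.elim (u ∘ Sum.inl) 0 := by
  simp only [toLTISystem, Matrix.fromBlocks_mulVec]
  ext (i | i) <;> simp

theorem B_mulVec (u : F.InputIdx → ℝ) : F.toLTISystem.B *ᵥ u =
    F.mkState (F.B0a *ᵥ (u ∘ Sum.inl)) (F.B0b *ᵥ (u ∘ Sum.inl))
      (F.B0c *ᵥ (u ∘ Sum.inl) + F.Bc *ᵥ (u ∘ Sum.inr ∘ Sum.inr))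
      (F.B0d *ᵥ (u ∘ Sum.inl) + F.Bd *ᵥ (u ∘ Sum.inr ∘ Sum.inl)) := by
  simp only [toLTISystem, B0, Matrix.fromRows_mulVec, Matrix.fromCols_mulVec,
    Matrix.fromBlocks_mulVec]
  ext ((i | i) | (i | i)) <;> simp [mkState, Function.comp_assoc]

theorem output_eq (u : ℝ → F.InputIdx → ℝ) (x : ℝ → F.StateIdx → ℝ) (t : ℝ) :
    F.toLTISystem.output u x t = Sum.elim (F.C0 *ᵥ x t + u t ∘ Sum.inl)
      (Sum.elim (F.Cd *ᵥ F.partD (x t)) (F.Cb *ᵥ F.partB (x t))) := by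
  rw [LTISystem.output, C_mulVec, D_mulVec]
  ext (i | i | i) <;> simp

theorem rhs_eq (x : F.StateIdx → ℝ) (u : F.InputIdx → ℝ) :
    F.toLTISystem.A *ᵥ x + F.toLTISystem.B *ᵥ u = F.mkState
      (F.Aa *ᵥ F.partA x + (F.Hab *ᵥ (F.Cb *ᵥ F.partB x) + F.Had *ᵥ (F.Cd *ᵥ F.partD x) +
        F.B0a *ᵥ (F.C0 *ᵥ x + u ∘ Sum.inl)))
      (F.Ab *ᵥ F.partB x + (F.Hbd *ᵥ (F.Cd *ᵥ F.partD x) +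
        F.B0b *ᵥ (F.C0 *ᵥ x + u ∘ Sum.inl)))
      (F.Ac *ᵥ F.partC x + F.Bc *ᵥ (F.Fca *ᵥ F.partA x + u ∘ Sum.inr ∘ Sum.inr) +
        (F.Hcb *ᵥ (F.Cb *ᵥ F.partB x) + F.Hcd *ᵥ (F.Cd *ᵥ F.partD x) +
        F.B0c *ᵥ (F.C0 *ᵥ x + u ∘ Sum.inl)))
      (chainShift F.q *ᵥ F.partD x + (F.Bd *ᵥ (F.Fda *ᵥ F.partA x + F.Fdb *ᵥ F.partB x +
        F.Fdc *ᵥ F.partC x + F.Fdd *ᵥ F.partD x + u ∘ Sum.inr ∘ Sum.inl) +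
        F.Hdd *ᵥ (F.Cd *ᵥ F.partD x) + F.B0d *ᵥ (F.C0 *ᵥ x + u ∘ Sum.inl))) := by
  have hA : (x ∘ Sum.inl) ∘ Sum.inl = F.partA x := rfl
  have hB : (x ∘ Sum.inl) ∘ Sum.inr = F.partB x := rfl
  have hC : (x ∘ Sum.inr) ∘ Sum.inl = F.partC x := rfl
  have hD : (x ∘ Sum.inr) ∘ Sum.inr = F.partD x := rfl
  rw [B_mulVec]
  simp only [toLTISystem, Matrix.add_mulVec, Matrix.fromBlocks_mulVec, ← Matrix.mulVec_mulVec, B0,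
    Matrix.fromRows_mulVec, hA, hB, hC, hD, Matrix.mulVec_add, Matrix.zero_mulVec, Ad]
  ext ((i | i) | (i | i)) <;> simp [mkState] <;> ring

section trajectory

variable {F} {u : ℝ → F.InputIdx → ℝ} {x : ℝ → F.StateIdx → ℝ}

theorem isTrajectory_partA (h : IsTrajectory F.toLTISystem.A F.toLTISystem.B u x) :
    IsTrajectory F.Aa 1 (fun t => F.Hab *ᵥ (F.Cb *ᵥ F.partB (x t)) +
      F.Had *ᵥ (F.Cd *ᵥ F.partD (x t)) + F.B0a *ᵥ (F.C0 *ᵥ x t + u t ∘ Sum.inl))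
      (fun t => F.partA (x t)) :=
  h.map_forced F.partA fun t => by rw [rhs_eq, partA_mkState]

/-- The output injection `K` is free because `C_b x_b` is an output: `K = 0` keeps the pure chain
for zero output, and `chainGain` makes the equation stable for output tending to zero. -/
theorem isTrajectory_partB (h : IsTrajectory F.toLTISystem.A F.toLTISystem.B u x)
    (K : Matrix (Σ i, Fin (F.l i)) (Fin F.pb) ℝ) :
    IsTrajectory (chainShift F.l - K * F.Cb) 1 (fun t => (K + F.Hbb) *ᵥ (F.Cb *ᵥ F.partB (x t)) +
      F.Hbd *ᵥ (F.Cd *ᵥ F.partD (x t)) + F.B0b *ᵥ (F.C0 *ᵥ x t + u t ∘ Sum.inl))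
      (fun t => F.partB (x t)) :=
  h.map_forced F.partB fun t => by
    rw [rhs_eq, partB_mkState, Ab, Matrix.add_mulVec, Matrix.add_mulVec, Matrix.sub_mulVec,
      Matrix.mulVec_mulVec _ K, Matrix.mulVec_mulVec _ F.Hbb]
    abel

theorem isTrajectory_partD (h : IsTrajectory F.toLTISystem.A F.toLTISystem.B u x) :
    IsTrajectory (chainShift F.q) 1 (fun t =>
      F.Bd *ᵥ (F.Fda *ᵥ F.partA (x t) + F.Fdb *ᵥ F.partB (x t) +
        F.Fdc *ᵥ F.partC (x t) + F.Fdd *ᵥ F.partD (x t) + u t ∘ Sum.inr ∘ Sum.inl) +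
        F.Hdd *ᵥ (F.Cd *ᵥ F.partD (x t)) + F.B0d *ᵥ (F.C0 *ᵥ x t + u t ∘ Sum.inl))
      (fun t => F.partD (x t)) :=
  h.map_forced F.partD fun t => by rw [rhs_eq, partD_mkState]

theorem outputs_eq_zero {t : ℝ} (hy : F.toLTISystem.output u x t = 0) :
    F.C0 *ᵥ x t + u t ∘ Sum.inl = 0 ∧ F.Cd *ᵥ F.partD (x t) = 0 ∧ F.Cb *ᵥ F.partB (x t) = 0 := by
  rw [output_eq, ← Sum.elim_zero_zero, Sum.elim_eq_iff, ← Sum.elim_zero_zero, Sum.elim_eq_iff] at hy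
  exact hy

theorem partB_eq_zero (h : IsTrajectory F.toLTISystem.A F.toLTISystem.B u x)
    (hy : ∀ t : ℝ, 0 ≤ t → F.toLTISystem.output u x t = 0) : ∀ t : ℝ, 0 ≤ t → F.partB (x t) = 0 := by
  have h1 := isTrajectory_partB h 0
  rw [Matrix.zero_mul, sub_zero] at h1
  refine h1.chain_eq_zero F.l_pos (fun t ht => (outputs_eq_zero (hy t ht)).2.2) fun t ht s hs => ?_
  obtain ⟨h0, hd, hb⟩ := outputs_eq_zero (hy t ht)
  simp [h0, hd, hb]

theorem partD_eq_zero (h : IsTrajectory F.toLTISystem.A F.toLTISystem.B u x)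
    (hy : ∀ t : ℝ, 0 ≤ t → F.toLTISystem.output u x t = 0) : ∀ t : ℝ, 0 ≤ t → F.partD (x t) = 0 := by
  refine (isTrajectory_partD h).chain_eq_zero F.q_pos (fun t ht => (outputs_eq_zero (hy t ht)).2.1)
    fun t ht s hs => ?_
  obtain ⟨h0, hd, hb⟩ := outputs_eq_zero (hy t ht)
  simp only [h0, hd, Matrix.mulVec_zero, add_zero]
  rw [Bd, chainInput_mulVec, if_neg hs.ne]

theorem tendsto_of_parts (ha : Tendsto (fun t => F.partA (x t)) atTop (𝓝 0))
    (hb : Tendsto (fun t => F.partB (x t)) atTop (𝓝 0))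
    (hc : Tendsto (fun t => F.partC (x t)) atTop (𝓝 0))
    (hd : Tendsto (fun t => F.partD (x t)) atTop (𝓝 0)) : Tendsto x atTop (𝓝 0) := by
  rw [tendsto_pi_nhds] at *
  rintro ((i | i) | (i | i))
  exacts [ha i, hb i, hc i, hd i]

end trajectory

variable {F}

/-! ### Realising prescribed motions, and the equivalences in special coordinates. -/

/-- The choice `u_0 = -C_0 x` makes `y_0 = 0`, and `u_d`, `u_c` absorb the feedback through `B_d`
and `B_c`; so `r` and `w` act as free inputs. -/
theorem exists_input {xa : ℝ → Fin F.na → ℝ} {xb : ℝ → (Σ i, Fin (F.l i)) → ℝ}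
    {xc : ℝ → Fin F.nc → ℝ} {xd : ℝ → (Σ i, Fin (F.q i)) → ℝ} {w : ℝ → Fin F.mc → ℝ}
    {r : ℝ → Fin F.md → ℝ} (hw : Continuous w) (hr : Continuous r)
    (ha : ∀ t, HasDerivAt xa
      (F.Aa *ᵥ xa t + (F.Hab *ᵥ (F.Cb *ᵥ xb t) + F.Had *ᵥ (F.Cd *ᵥ xd t))) t)
    (hb : ∀ t, HasDerivAt xb (F.Ab *ᵥ xb t + F.Hbd *ᵥ (F.Cd *ᵥ xd t)) t)
    (hc : ∀ t, HasDerivAt xc (F.Ac *ᵥ xc t + F.Bc *ᵥ w t +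
      (F.Hcb *ᵥ (F.Cb *ᵥ xb t) + F.Hcd *ᵥ (F.Cd *ᵥ xd t))) t)
    (hd : ∀ t, HasDerivAt xd (chainShift F.q *ᵥ xd t + (F.Bd *ᵥ r t + F.Hdd *ᵥ (F.Cd *ᵥ xd t))) t) :
    ∃ u, IsTrajectory F.toLTISystem.A F.toLTISystem.B u
        (fun t => F.mkState (xa t) (xb t) (xc t) (xd t)) ∧
      ∀ t, F.toLTISystem.output u (fun t => F.mkState (xa t) (xb t) (xc t) (xd t)) t =
        Sum.elim (0 : Fin F.m0 → ℝ) (Sum.elim (F.Cd *ᵥ xd t) (F.Cb *ᵥ xb t)) := by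
  have hxa : Continuous xa := continuous_iff_continuousAt.2 fun t => (ha t).continuousAt
  have hxb : Continuous xb := continuous_iff_continuousAt.2 fun t => (hb t).continuousAt
  have hxc : Continuous xc := continuous_iff_continuousAt.2 fun t => (hc t).continuousAt
  have hxd : Continuous xd := continuous_iff_continuousAt.2 fun t => (hd t).continuousAt
  set x : ℝ → F.StateIdx → ℝ := fun t => F.mkState (xa t) (xb t) (xc t) (xd t) with hx
  have hxcont : Continuous x := by
    refine continuous_pi ?_
    rintro ((i | i) | (i | i))
    exacts [(continuous_apply i).comp hxa, (continuous_apply i).comp hxb,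
      (continuous_apply i).comp hxc, (continuous_apply i).comp hxd]
  let u : ℝ → F.InputIdx → ℝ := fun t => Sum.elim (-(F.C0 *ᵥ x t))
    (Sum.elim (r t - (F.Fda *ᵥ xa t + F.Fdb *ᵥ xb t + F.Fdc *ᵥ xc t + F.Fdd *ᵥ xd t))
      (w t - F.Fca *ᵥ xa t))
  have hu : Continuous u := by
    have h0 : Continuous fun t => -(F.C0 *ᵥ x t) := by fun_prop
    have h1 : Continuous fun t =>
      r t - (F.Fda *ᵥ xa t + F.Fdb *ᵥ xb t + F.Fdc *ᵥ xc t + F.Fdd *ᵥ xd t) := by fun_prop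
    have h2 : Continuous fun t => w t - F.Fca *ᵥ xa t := by fun_prop
    refine continuous_pi ?_
    rintro (i | i | i)
    exacts [(continuous_apply i).comp h0, (continuous_apply i).comp h1, (continuous_apply i).comp h2]
  have hu0 : ∀ t, F.C0 *ᵥ x t + u t ∘ Sum.inl = 0 := fun t => by
    simp only [u, Sum.elim_comp_inl, add_neg_cancel]
  refine ⟨u, IsTrajectory.of_hasDerivAt hu fun t => ?_, fun t => ?_⟩
  · rw [rhs_eq, hu0]
    have h1 : F.Fca *ᵥ xa t + u t ∘ Sum.inr ∘ Sum.inr = w t := by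
      ext i; simp [u]
    have h2 : F.Fda *ᵥ xa t + F.Fdb *ᵥ xb t + F.Fdc *ᵥ xc t + F.Fdd *ᵥ xd t +
        u t ∘ Sum.inr ∘ Sum.inl = r t := by
      ext i; simp [u]
    simp only [hx, partA_mkState, partB_mkState, partC_mkState, partD_mkState, h1, h2,
      Matrix.mulVec_zero, add_zero]
    rw [hasDerivAt_pi]
    rintro ((i | i) | (i | i))
    exacts [hasDerivAt_pi.1 (ha t) i, hasDerivAt_pi.1 (hb t) i, hasDerivAt_pi.1 (hc t) i,
      hasDerivAt_pi.1 (hd t) i]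
  · rw [output_eq, hu0]; rfl

theorem exists_input_of_free {xa : ℝ → Fin F.na → ℝ} (ha : ∀ t, HasDerivAt xa (F.Aa *ᵥ xa t) t) :
    ∃ u, IsTrajectory F.toLTISystem.A F.toLTISystem.B u (fun t => F.mkState (xa t) 0 0 0) ∧
      ∀ t, F.toLTISystem.output u (fun t => F.mkState (xa t) 0 0 0) t = 0 := by
  obtain ⟨u, h1, h2⟩ := exists_input (F := F) (xa := xa) (xb := 0) (xc := 0) (xd := 0) (w := 0)
    (r := 0) continuous_const continuous_const (fun t => by simpa using ha t)
    (fun t => by simp) (fun t => by simp)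
    (fun t => by simp)
  exact ⟨u, h1, fun t => (h2 t).trans (by simp)⟩

theorem isEmpty_of_stronglyDetectable (h : F.toLTISystem.StronglyDetectable) :
    IsEmpty (Fin F.nc) := by
  refine F.controllable_c.isEmpty fun v w hvw => ?_
  obtain ⟨u, h1, h2⟩ := exists_input (F := F) (xa := 0) (xb := 0) (xc := fun _ => v) (xd := 0)
    (w := fun _ => w) (r := 0) continuous_const continuous_const
    (fun t => by simp)
    (fun t => by simp)
    (fun t => by simpa [hvw] using hasDerivAt_const t v)
    (fun t => by simp)
  have h3 := h u _ h1 fun t _ => (h2 t).trans (by simp)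
  have h4 := (F.partC.continuous.tendsto 0).comp h3
  rw [map_zero] at h4
  exact tendsto_nhds_unique tendsto_const_nhds h4

theorem isHurwitz_of_stronglyDetectable (h : F.toLTISystem.StronglyDetectable) :
    IsHurwitz F.Aa := by
  intro z hz
  obtain ⟨x, y, hx, hy, i, c, hc, hxy⟩ := exists_mode_of_mem_spectrum hz
  by_contra! hre
  have key : ∀ w : ℝ → Fin F.na → ℝ, (∀ t, HasDerivAt w (F.Aa *ᵥ w t) t) →
      Tendsto (fun t => w t i) atTop (𝓝 0) := fun w hw => by
    obtain ⟨u, h1, h2⟩ := exists_input_of_free hw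
    have h3 := h u _ h1 fun t _ => h2 t
    exact tendsto_pi_nhds.1 h3 (Sum.inl (Sum.inl i))
  have h1 := (((key x hx).pow 2).add ((key y hy).pow 2)).congr hxy
  -- When `z.re ≥ 0`, the sum of squares stays at least `c` for `t ≥ 0`, although it tends to zero.
  have h2 : c ≤ 0 ^ 2 + 0 ^ 2 := by
    refine ge_of_tendsto h1 ?_
    filter_upwards [eventually_ge_atTop 0] with t ht
    have : 1 ≤ Real.exp (2 * z.re * t) := Real.one_le_exp (by positivity)
    nlinarith
  norm_num at h2
  linarith

theorem isEmpty_of_stronglyObservable (h : F.toLTISystem.StronglyObservable) :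
    IsEmpty (Fin F.na) := by
  by_contra hne
  rw [not_isEmpty_iff] at hne
  obtain ⟨z, hz⟩ := spectrum.nonempty_of_isAlgClosed_of_finiteDimensional ℂ
    (F.Aa.map Complex.ofReal)
  obtain ⟨x, y, hx, hy, i, c, hc, hxy⟩ := exists_mode_of_mem_spectrum hz
  have key : ∀ w : ℝ → Fin F.na → ℝ, (∀ t, HasDerivAt w (F.Aa *ᵥ w t) t) → w 0 i = 0 := by
    intro w hw
    obtain ⟨u, h1, h2⟩ := exists_input_of_free hw
    exact congrFun (h u _ h1 (fun t _ => h2 t) 0 le_rfl) (Sum.inl (Sum.inl i))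
  have := hxy 0
  rw [key x hx, key y hy] at this
  simp at this
  linarith

theorem isEmpty_fin_iff {n : ℕ} : IsEmpty (Fin n) ↔ n = 0 := by
  rw [← Fintype.card_eq_zero_iff, Fintype.card_fin]

theorem stronglyObservable_iff :
    F.toLTISystem.StronglyObservable ↔ F.na = 0 ∧ F.nc = 0 := by
  refine ⟨fun h => ⟨isEmpty_fin_iff.1 (isEmpty_of_stronglyObservable h),
    isEmpty_fin_iff.1 (isEmpty_of_stronglyDetectable h.stronglyDetectable)⟩, ?_⟩
  rintro ⟨ha, hc⟩ u x hx hy t ht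
  have := isEmpty_fin_iff.2 ha
  have := isEmpty_fin_iff.2 hc
  rw [← F.mkState_parts (x t), partB_eq_zero hx hy t ht, partD_eq_zero hx hy t ht]
  ext ((i | i) | (i | i))
  exacts [isEmptyElim i, rfl, isEmptyElim i, rfl]

theorem stronglyDetectable_iff :
    F.toLTISystem.StronglyDetectable ↔ F.nc = 0 ∧ IsHurwitz F.Aa := by
  refine ⟨fun h => ⟨isEmpty_fin_iff.1 (isEmpty_of_stronglyDetectable h),
    isHurwitz_of_stronglyDetectable h⟩, ?_⟩
  rintro ⟨hc, ha⟩ u x hx hy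
  have := isEmpty_fin_iff.2 hc
  refine tendsto_of_parts (ha.tendsto_zero (isTrajectory_partA hx) ?_) ?_ ?_ ?_
  · refine tendsto_const_nhds.congr' ?_
    filter_upwards [eventually_ge_atTop 0] with t ht
    obtain ⟨h0, hd, hb⟩ := outputs_eq_zero (hy t ht)
    simp [h0, hd, hb]
  · refine tendsto_const_nhds.congr' ?_
    filter_upwards [eventually_ge_atTop 0] with t ht using (partB_eq_zero hx hy t ht).symm
  · exact tendsto_const_nhds.congr fun t => Subsingleton.elim _ _
  · refine tendsto_const_nhds.congr' ?_
    filter_upwards [eventually_ge_atTop 0] with t ht using (partD_eq_zero hx hy t ht).symm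

theorem strongStarDetectable_of_forall_eq_one (h : F.toLTISystem.StronglyDetectable)
    (hq : ∀ i, F.q i = 1) : F.toLTISystem.StrongStarDetectable := by
  obtain ⟨hc, ha⟩ := stronglyDetectable_iff.1 h
  have := isEmpty_fin_iff.2 hc
  intro u x hx hy
  have h0 : Tendsto (fun t => F.C0 *ᵥ x t + u t ∘ Sum.inl) atTop (𝓝 0) := by
    rw [tendsto_pi_nhds] at hy ⊢
    exact fun i => (hy (Sum.inl i)).congr fun t => by rw [output_eq]; rfl
  have hd : Tendsto (fun t => F.Cd *ᵥ F.partD (x t)) atTop (𝓝 0) := by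
    rw [tendsto_pi_nhds] at hy ⊢
    exact fun i => (hy (Sum.inr (Sum.inl i))).congr fun t => by rw [output_eq]; rfl
  have hb : Tendsto (fun t => F.Cb *ᵥ F.partB (x t)) atTop (𝓝 0) := by
    rw [tendsto_pi_nhds] at hy ⊢
    exact fun i => (hy (Sum.inr (Sum.inr i))).congr fun t => by rw [output_eq]; rfl
  refine tendsto_of_parts (ha.tendsto_zero (isTrajectory_partA hx) ?_)
    ((isHurwitz_chainShift_sub F.l_pos).tendsto_zero (isTrajectory_partB hx (chainGain F.l)) ?_)
    (tendsto_const_nhds.congr fun t => Subsingleton.elim _ _) ?_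
  · simpa using ((hb.mulVec_zero F.Hab).add (hd.mulVec_zero F.Had)).add (h0.mulVec_zero F.B0a)
  · simpa using ((hb.mulVec_zero (chainGain F.l + F.Hbb)).add (hd.mulVec_zero F.Hbd)).add
      (h0.mulVec_zero F.B0b)
  · rw [tendsto_pi_nhds] at hd ⊢
    rintro ⟨i, j⟩
    obtain rfl : j = ⟨0, F.q_pos i⟩ := by
      have h1 := hq i
      have h2 := j.2
      exact Fin.ext (by change (j : ℕ) = 0; omega)
    exact (hd i).congr fun t => by rw [Cd, chainOutput_mulVec_real F.q_pos]

theorem eq_one_of_strongStarDetectable (h : F.toLTISystem.StrongStarDetectable) :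
    ∀ i, F.q i = 1 := by
  have hempty := isEmpty_of_stronglyDetectable h.stronglyDetectable
  intro i
  by_contra hi
  have hi2 : 1 < F.q i := by have := F.q_pos i; omega
  obtain ⟨x, f, hf, hx, hxlim, hf0, hf1⟩ := exists_oscillating_response
    (Matrix.fromBlocks F.Aa (F.Hab * F.Cb) 0 F.Ab)
    (Sum.elim (F.Had *ᵥ Pi.single i 1) (F.Hbd *ᵥ Pi.single i 1))
  -- The default `0` past the end of a chain lets the recursion for `W` be differentiated at `m =
  -- F.q j` too, giving continuity of the input.
  let H : Fin F.md → ℕ → ℝ := fun j m => if hm : m < F.q j then F.Hdd ⟨j, ⟨m, hm⟩⟩ i else 0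
  -- Solves each chain from its output upwards: the first state is `f` on chain `i` and `0`
  -- elsewhere, and each next state is the derivative of the current one minus the injected `H f`.
  -- The term after the last state is the required input `r`.
  let W : Fin F.md → ℕ → ℝ → ℝ := fun j m t =>
    (if j = i then f m t else 0) - ∑ k ∈ Finset.range m, H j k * f (m - 1 - k) t
  have hW : ∀ j m t, HasDerivAt (W j m) (W j (m + 1) t + H j m * f 0 t) t := fun j m t => by
    have h1 : HasDerivAt (fun t => if j = i then f m t else 0) (if j = i then f (m + 1) t else 0) t := by
      split_ifs
      · exact hf m t
      · exact hasDerivAt_const t 0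
    have h2 : HasDerivAt (fun t => ∑ k ∈ Finset.range m, H j k * f (m - 1 - k) t)
        (∑ k ∈ Finset.range m, H j k * f (m - k) t) t := by
      refine HasDerivAt.fun_sum fun k hk => ?_
      have := (hf (m - 1 - k) t).const_mul (H j k)
      rwa [show m - 1 - k + 1 = m - k by have := Finset.mem_range.1 hk; omega] at this
    refine (h1.sub h2).congr_deriv ?_
    simp only [W, Finset.sum_range_succ, Nat.add_sub_cancel, Nat.sub_self]
    ring
  let xd : ℝ → (Σ i, Fin (F.q i)) → ℝ := fun t s => W s.1 s.2 t
  have hCd : ∀ t, F.Cd *ᵥ xd t = f 0 t • Pi.single i 1 := fun t => by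
    ext j
    rw [Cd, chainOutput_mulVec_real F.q_pos]
    simp [xd, W, Pi.single_apply]
  obtain ⟨u, h1, h2⟩ := exists_input (F := F) (xa := fun t => x t ∘ Sum.inl)
    (xb := fun t => x t ∘ Sum.inr) (xc := 0) (xd := xd) (w := 0) (r := fun t j => W j (F.q j) t)
    continuous_const
    (continuous_pi fun j => continuous_iff_continuousAt.2 fun t => (hW j (F.q j) t).continuousAt)
    (fun t => by
      refine hasDerivAt_pi.2 fun k => ((hasDerivAt_pi.1 (hx t)) (Sum.inl k)).congr_deriv ?_
      simp [hCd, Matrix.fromBlocks_mulVec, Matrix.mulVec_smul, Matrix.mulVec_mulVec]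
      ring)
    (fun t => by
      refine hasDerivAt_pi.2 fun k => ((hasDerivAt_pi.1 (hx t)) (Sum.inr k)).congr_deriv ?_
      simp [hCd, Matrix.fromBlocks_mulVec, Matrix.mulVec_smul])
    (fun t => (hasDerivAt_const t (0 : Fin F.nc → ℝ)).congr_deriv (Subsingleton.elim _ _))
    (fun t => by
      refine hasDerivAt_pi.2 fun s => (hW s.1 s.2 t).congr_deriv ?_
      have hs := s.2.2
      rw [hCd, Matrix.mulVec_smul, Matrix.mulVec_single_one, Pi.add_apply, Pi.add_apply,
        chainShift_mulVec_real, Bd, chainInput_mulVec]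
      by_cases hlt : (s.2 : ℕ) + 1 < F.q s.1
      · simp [hlt, hlt.ne, xd, H, Matrix.col]; ring
      · have heq : (s.2 : ℕ) + 1 = F.q s.1 := by omega
        simp [heq, H, Matrix.col]; ring)
  have hylim : Tendsto (F.toLTISystem.output u
      fun t => F.mkState (x t ∘ Sum.inl) (x t ∘ Sum.inr) 0 (xd t)) atTop (𝓝 0) := by
    refine Tendsto.congr (fun t => (h2 t).symm) ?_
    have hb : Tendsto (fun t => F.Cb *ᵥ (x t ∘ Sum.inr)) atTop (𝓝 0) := by
      refine Tendsto.mulVec_zero _ ?_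
      rw [tendsto_pi_nhds] at hxlim ⊢
      exact fun k => hxlim (Sum.inr k)
    have hd : Tendsto (fun t => F.Cd *ᵥ xd t) atTop (𝓝 0) := by
      simp only [hCd]
      simpa using hf0.smul_const (Pi.single i 1 : Fin F.md → ℝ)
    rw [tendsto_pi_nhds] at hb hd ⊢
    rintro (k | k | k)
    exacts [tendsto_const_nhds, hd k, hb k]
  have h3 := tendsto_pi_nhds.1 (h u _ h1 hylim) (Sum.inr (Sum.inr ⟨i, ⟨1, hi2⟩⟩))
  have h4 : Tendsto (fun t => f 1 t - H i 0 * f 0 t) atTop (𝓝 0) :=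
    h3.congr fun t => by simp [mkState, xd, W]
  refine hf1 ?_
  simpa using h4.add (hf0.const_mul (H i 0))

theorem observerKernelCondition_iff (hc : F.nc = 0) (hinj : F.toLTISystem.InputInjective) :
    F.toLTISystem.ObserverKernelCondition ↔ ∀ i, F.q i = 1 := by
  have := isEmpty_fin_iff.2 hc
  have hCB : ∀ v : Fin F.md → ℝ, F.Cd *ᵥ (F.Bd *ᵥ v) = fun i => if F.q i = 1 then v i else 0 := by
    intro v
    ext i
    rw [Cd, chainOutput_mulVec_real F.q_pos, Bd, chainInput_mulVec]
    simp [eq_comm]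
  constructor
  · intro h i
    by_contra hi
    have := h (Sum.elim 0 (Sum.elim (Pi.single i 1) 0)) (by
        rw [D_mulVec, Sum.elim_comp_inl, Sum.elim_zero_zero])
      ⟨Sum.elim (F.C0 *ᵥ (F.toLTISystem.B *ᵥ Sum.elim 0 (Sum.elim (Pi.single i 1) 0))) 0, by
        rw [D_mulVec, ← Matrix.mulVec_mulVec, C_mulVec]
        have h1 : F.Cd *ᵥ F.partD (F.toLTISystem.B *ᵥ Sum.elim 0 (Sum.elim (Pi.single i 1) 0)) = 0 := by
          rw [B_mulVec, partD_mkState, Sum.elim_comp_inl, Matrix.mulVec_zero, zero_add]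
          refine (hCB (Pi.single i 1)).trans ?_
          ext j
          by_cases hj : j = i
          · subst hj; simp [hi]
          · simp [hj]
        have h2 : F.Cb *ᵥ F.partB (F.toLTISystem.B *ᵥ Sum.elim 0 (Sum.elim (Pi.single i 1) 0)) = 0 := by
          rw [B_mulVec, partB_mkState, Sum.elim_comp_inl, Matrix.mulVec_zero, Matrix.mulVec_zero]
        rw [h1, h2]; simp⟩
    simpa using congrFun this (Sum.inr (Sum.inl i))
  · rintro hq v hDv ⟨w, hw⟩
    have h0 : v ∘ Sum.inl = 0 := by
      ext i
      rw [D_mulVec] at hDv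
      exact congrFun hDv (Sum.inl i)
    have hd : v ∘ Sum.inr ∘ Sum.inl = 0 := by
      rw [← Matrix.mulVec_mulVec, C_mulVec, D_mulVec, Sum.elim_eq_iff, ← Sum.elim_zero_zero,
        Sum.elim_eq_iff, B_mulVec, partD_mkState, h0, Matrix.mulVec_zero F.B0d, zero_add, hCB] at hw
      ext i
      simpa [hq] using congrFun hw.2.1 i
    -- Only `u_c` can still be nonzero. It does not enter `D`, and it enters the state only through
    -- `x_c`, which is empty; so injectivity of the input map eliminates it.
    refine hinj v ?_ hDv
    rw [B_mulVec, h0, hd]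
    ext ((i | i) | (i | i))
    · simp [mkState]
    · simp [mkState]
    · exact isEmptyElim i
    · simp [mkState]

end SCBForm

theorem mainTheorem5 (n m p : ℕ) (S : LTISystem (Fin n) (Fin m) (Fin p))
    (hBD : (Matrix.fromRows S.B S.D).rank = m)
    (hCD : (Matrix.fromCols S.C S.D).rank = p)
    (scb : S.SCB) :
    (S.StronglyObservable ↔ scb.form.na = 0 ∧ scb.form.nc = 0) ∧
    (S.StronglyDetectable ↔ scb.form.nc = 0 ∧ IsHurwitz scb.form.Aa) ∧
    (S.StrongStarDetectable ↔ S.StronglyDetectable ∧ ∀ i, scb.form.q i = 1) ∧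
    (S.StronglyDetectable → (S.ObserverRankCondition ↔ ∀ i, scb.form.q i = 1)) := by
  have hs := scb.similar
  have hdet : S.StronglyDetectable ↔ scb.form.toLTISystem.StronglyDetectable :=
    ⟨hs.stronglyDetectable, hs.symm.stronglyDetectable⟩
  have hrank : (Matrix.fromRows S.B S.D).rank = Fintype.card (Fin m) := by
    rw [hBD, Fintype.card_fin]
  refine ⟨?_, ?_, ⟨fun h => ⟨h.stronglyDetectable,
    SCBForm.eq_one_of_strongStarDetectable (hs.strongStarDetectable h)⟩, fun h =>
    hs.symm.strongStarDetectable (SCBForm.strongStarDetectable_of_forall_eq_one (hdet.1 h.1) h.2)⟩,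
    fun h => ?_⟩
  · rw [← SCBForm.stronglyObservable_iff]
    exact ⟨hs.stronglyObservable, hs.symm.stronglyObservable⟩
  · rw [hdet, SCBForm.stronglyDetectable_iff]
  · rw [LTISystem.observerRankCondition_iff hrank, ← SCBForm.observerKernelCondition_iff
      (SCBForm.stronglyDetectable_iff.1 (hdet.1 h)).1
      (hs.inputInjective (LTISystem.inputInjective_of_rank hrank))]
    exact ⟨hs.observerKernelCondition, hs.symm.observerKernelCondition⟩
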